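/- Let $K$ be a field, $S=K[x_1,\dots,x_n]$, and let $I\subset S$ be a canonical critical monomial ideal; that is, up to a permutation of the variables, $$I=(x_1m_1,\;x_2m_1m_2,\;\dots,\;x_{t-1}m_1\cdots m_{t-1},\;m_1\cdots m_t),$$ where $1\le t\le n$, each $m_i$ is a monomial in $K[x_i,x_{i+1},\dots,x_n]$, and $\deg m_t>0$. Let $G(I)$ be the unique minimal system of monomial generators of $I$. Then $|G(I)|=t$ and $$\operatorname{sdepth}(S/I)=\operatorname{depth}(S/I)=n-|G(I)|=n-t .$$ Here $\operatorname{depth}(M)$ is the maximal length of an $M$-regular sequence contained in $(x_1,\dots,x_n)$. A Stanley decomposition of a finitely generated $\mathbb Z^n$-graded $S$-module $M\neq 0$ is a finite direct sum decomposition $\mathcal D: M=\bigoplus_{i=1}^r u_iK[Z_i]$ as a $K$-vector space, where each $u_i\in M$ is homogeneous, $Z_i\subseteq\{x_1,\dots,x_n\}$, and $u_iK[Z_i]$ is a free $K[Z_i]$-module; one sets $\operatorname{sdepth}(\mathcal D)=\min_i|Z_i|$, and $\operatorname{sdepth}(M)$ is the maximum of $\operatorname{sdepth}(\mathcal D)$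 over all Stanley decompositions $\mathcal D$ of $M$. The module $S/I$ carries the $\mathbb Z^n$-grading induced by the exponents of monomials. -/

import Mathlib

noncomputable section

namespace CriticalIdeal

open MvPolynomial

/-! ### Depth -/

/-- The depth of a module `M` over `S = K[x_1, …, x_n]`: the supremum of the lengths of the
`M`-regular sequences contained in the graded maximal ideal `(x_1, …, x_n)`. -/
def depth (K : Type*) [Field K] (n : ℕ) (M : Type*) [AddCommGroup M]
    [Module (MvPolynomial (Fin n) K) M] : ℕ∞ :=
  ⨆ rs ∈ {rs : List (MvPolynomial (Fin n) K) |
      (∀ r ∈ rs, r ∈ idealOfVars (Fin n) K) ∧ RingTheory.Sequence.IsRegular M rs},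
    (rs.length : ℕ∞)

/-! ### Stanley decompositions and Stanley depth -/

section Stanley

variable {K : Type*} [Field K] {n : ℕ} {M : Type*} [AddCommGroup M] [Module K M]
  [Module (MvPolynomial (Fin n) K) M] [IsScalarTower K (MvPolynomial (Fin n) K) M]

/-- The `K`-subspace `u K[Z]` of `M`, where `u ∈ M` and `Z` is a set of variables. -/
def stanleySpace (u : M) (Z : Finset (Fin n)) : Submodule K M :=
  (Subalgebra.toSubmodule (supported K (Z : Set (Fin n)))).map
    ((LinearMap.toSpanSingleton (MvPolynomial (Fin n) K) M u).restrictScalars K)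

/-- A Stanley decomposition `M = ⨁_{i < r} u_i K[Z_i]` of a `ℤⁿ`-graded module `M` whose
component of degree `a` is `𝓜 a`: a finite family of homogeneous elements `u_i` and of sets of
variables `Z_i` such that each `u_i K[Z_i]` is a free `K[Z_i]`-module (with basis `u_i`) and `M`
is the internal direct sum of these `K`-subspaces. -/
structure StanleyDecomposition (𝓜 : (Fin n → ℤ) → Submodule K M) where
  /-- number of summands -/
  r : ℕ
  /-- generators -/
  u : Fin r → M
  /-- sets of variables -/
  Z : Fin r → Finset (Fin n)
  homogeneous : ∀ i, ∃ a, u i ∈ 𝓜 a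
  free : ∀ i, Set.InjOn (fun f : MvPolynomial (Fin n) K => f • u i)
    (supported K (Z i : Set (Fin n)))
  isInternal : DirectSum.IsInternal fun i => (stanleySpace (u i) (Z i) : Submodule K M)

/-- The Stanley depth `min_i |Z_i|` of a Stanley decomposition. -/
def StanleyDecomposition.sdepth {𝓜 : (Fin n → ℤ) → Submodule K M}
    (D : StanleyDecomposition 𝓜) : ℕ∞ :=
  ⨅ i, ((D.Z i).card : ℕ∞)

/-- The Stanley depth of a `ℤⁿ`-graded module: the largest Stanley depth of a Stanley
decomposition. -/
def sdepth (𝓜 : (Fin n → ℤ) → Submodule K M) : ℕ∞ :=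
  ⨆ D : StanleyDecomposition 𝓜, D.sdepth

end Stanley

/-! ### Monomial ideals -/

section Monomial

variable {K : Type*} [Field K] {n : ℕ}

/-- The `ℤⁿ`-grading of `S / I` for a monomial ideal `I`: the component of degree `a` is the image
of the space of the polynomials that only involve the monomial of exponent vector `a` (so it is
zero if `a` has a negative entry). -/
def quotientGrading (I : Ideal (MvPolynomial (Fin n) K)) (a : Fin n → ℤ) :
    Submodule K (MvPolynomial (Fin n) K ⧸ I) :=
  (restrictSupport K {d : Fin n →₀ ℕ | ∀ i, (d i : ℤ) = a i}).map
    (Ideal.Quotient.mkₐ K I).toLinearMap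

/-- The exponent vectors of `G(I)`, the minimal monomial system of generators of a monomial ideal
`I`: the monomials in `I` that are minimal with respect to divisibility. -/
def minimalGenerators (I : Ideal (MvPolynomial (Fin n) K)) : Set (Fin n →₀ ℕ) :=
  {d | Minimal (fun e => monomial e (1 : K) ∈ I) d}

/-- For a monomial ideal `I`, the set `minimalGenerators I` is the unique minimal one among the
sets of monomials that generate `I`. -/
theorem minimal_generating_iff {I : Ideal (MvPolynomial (Fin n) K)}
    (hI : ∃ s : Set (Fin n →₀ ℕ), Ideal.span ((fun d => monomial d (1 : K)) '' s) = I)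
    (s : Set (Fin n →₀ ℕ)) :
    Minimal (fun s : Set (Fin n →₀ ℕ) =>
      Ideal.span ((fun d => monomial d (1 : K)) '' s) = I) s ↔ s = minimalGenerators I := by
  have mem : ∀ (s : Set (Fin n →₀ ℕ)) (d : Fin n →₀ ℕ),
      monomial d (1 : K) ∈ Ideal.span ((fun d => monomial d (1 : K)) '' s) ↔
        ∃ e ∈ s, e ≤ d := by
    intro s d
    rw [mem_ideal_span_monomial_image]
    simp
  have sub : ∀ s : Set (Fin n →₀ ℕ), Ideal.span ((fun d => monomial d (1 : K)) '' s) = I →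
      minimalGenerators I ⊆ s := by
    rintro s rfl d hd
    obtain ⟨hd₁, hd₂⟩ := hd
    obtain ⟨e, he, hed⟩ := (mem s d).1 hd₁
    have := hd₂ ((mem s e).2 ⟨e, he, le_rfl⟩) hed
    rwa [le_antisymm this hed]
  have gen : Ideal.span ((fun d => monomial d (1 : K)) '' minimalGenerators I) = I := by
    apply le_antisymm
    · rw [Ideal.span_le]
      rintro _ ⟨d, hd, rfl⟩
      exact hd.1
    · obtain ⟨s, rfl⟩ := hI
      refine Ideal.span_le.2 ?_
      rintro _ ⟨d, hd, rfl⟩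
      have hd' := (mem s d).2 ⟨d, hd, le_rfl⟩
      obtain ⟨e, hed, he⟩ := exists_minimal_le_of_wellFoundedLT
        (fun e => monomial e (1 : K) ∈ Ideal.span ((fun d => monomial d (1 : K)) '' s)) d hd'
      exact (mem _ d).2 ⟨e, he, hed⟩
  constructor
  · intro h
    exact Set.Subset.antisymm (h.le_of_le gen (sub s h.prop)) (sub s h.prop)
  · rintro rfl
    exact ⟨gen, fun s hs _ => sub s hs⟩

/-- The ideal
`I_(m_1, …, m_t) = (x_1 m_1, x_2 m_1 m_2, …, x_{t-1} m_1 ⋯ m_{t-1}, m_1 ⋯ m_t)`,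
where the monomials are given by their exponent vectors and are indexed from zero. -/
def criticalIdeal (K : Type*) [Field K] {n t : ℕ} (htn : t ≤ n) (m : Fin t → Fin n →₀ ℕ) :
    Ideal (MvPolynomial (Fin n) K) :=
  Ideal.span
    ({p | ∃ i : Fin t, (i : ℕ) + 1 < t ∧
        p = X (Fin.castLE htn i) * ∏ k ∈ Finset.Iic i, monomial (m k) (1 : K)} ∪
      {∏ k, monomial (m k) (1 : K)})

/-- `I` is a canonical critical monomial ideal with parameter `t`: up to a permutation `π` of the
variables, `I = I_(m_1, …, m_t)` with `1 ≤ t ≤ n`, where `m_i` is a monomial in the variables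
`x_i, …, x_n` and `deg m_t > 0`. -/
def IsCanonicalCritical (t : ℕ) (I : Ideal (MvPolynomial (Fin n) K)) : Prop :=
  ∃ (ht : 1 ≤ t) (htn : t ≤ n) (m : Fin t → Fin n →₀ ℕ) (π : Equiv.Perm (Fin n)),
    (∀ (i : Fin t) (k : Fin n), k < Fin.castLE htn i → m i k = 0) ∧
    0 < (m ⟨t - 1, by omega⟩).degree ∧
    I = (criticalIdeal K htn m).map (rename π : MvPolynomial (Fin n) K →ₐ[K] _)

end Monomial

end CriticalIdeal

end

namespace CriticalIdeal

open RingTheory.Sequence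
open scoped Pointwise

/-! ### Regular sequences on quotients by ideals -/

section RegularSequences

variable {R : Type*} [CommRing R]

/-! Index from zero, write x_k for the variable `v k`, and put J_i = (x_0, …, x_{i-1}, x_i M_i,
x_{i+1} M_i M_{i+1}, …, M_i ⋯ M_{t-1}), so that J_0 = I. Since M_i avoids x_0, …, x_{i-1}, one has
J_i : M_i = J_{i+1} for i < t - 1, and J_i + (M_i) = (x_0, …, x_{i-1}, M_i) because M_i divides the
other generators. Splitting M_i into variables, S/I is assembled by extensions 0 → S/(J : u) → S/J →
S/(J + (u)) → 0 from zero modules and quotients S/(B), where B consists of x_0, …, x_{i-1} and one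
further variable, i < t (`CriticalData.hasFiltration_tailSet`).

Both lower bounds follow from this filtration. Let T be the complement of {x_0, …, x_{t-2}} and z ∈
T. Each B meets T at most once, so the n - t differences x_l - z, for l ∈ T other than z, are weakly
regular on every S/(B), and weak regularity passes through the extensions
(`HasFiltration.le_depth`). Each |B| ≤ t, and Stanley decompositions of the outer terms glue to one
of the middle term (`HasFiltration.exists_partition`).

Both upper bounds come from one associated prime. If x_j divides M_{t-1} and w = M_0 ⋯ M_{t-1} /
x_j, then I : w is generated by the t variables x_0, …, x_{t-2}, x_j
(`CriticalData.exists_colon_eq_variableSet`). Depth is at most the dimension of S modulo an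
associated prime inside the graded maximal ideal (`length_le_coheight`), and the Stanley summand
containing w cannot use any of these t variables (`StanleyDecomposition.sdepth_le_of_colon_eq`). -/

theorem isSMulRegular_quotient_iff (I : Ideal R) (r : R) :
    IsSMulRegular (R ⧸ I) r ↔ ∀ p, r * p ∈ I → p ∈ I := by
  rw [isSMulRegular_iff_right_eq_zero_of_smul]
  constructor
  · intro h p hp
    rw [← Ideal.Quotient.eq_zero_iff_mem] at hp ⊢
    exact h _ hp
  · intro h x hx
    obtain ⟨p, rfl⟩ := Ideal.Quotient.mk_surjective x
    exact Ideal.Quotient.eq_zero_iff_mem.2 (h p (Ideal.Quotient.eq_zero_iff_mem.1 hx))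

theorem isWeaklyRegular_quotient_cons_iff (I : Ideal R) (r : R) (rs : List R) :
    IsWeaklyRegular (R ⧸ I) (r :: rs) ↔
      (∀ p, r * p ∈ I → p ∈ I) ∧ IsWeaklyRegular (R ⧸ (I ⊔ Ideal.span {r})) rs := by
  rw [isWeaklyRegular_cons_iff, isSMulRegular_quotient_iff]
  have h : r • (⊤ : Submodule R (R ⧸ I)) = Submodule.map (Submodule.mkQ I) (Ideal.span {r}) := by
    rw [← Submodule.ideal_span_singleton_smul, ← (Submodule.range_mkQ I), ← Submodule.map_top,
      ← Submodule.map_smul'']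
    simp
  exact and_congr_right fun _ => LinearEquiv.isWeaklyRegular_congr
    ((Submodule.quotEquivOfEq _ _ h).trans
      (Submodule.quotientQuotientEquivQuotientSup I (Ideal.span {r}))) rs

/-- Weak regularity passes from `R ⧸ (I : u)` and `R ⧸ (I + (u))` to `R ⧸ I`. -/
theorem isWeaklyRegular_quotient_of_colon (u : R) (rs : List R) (I C : Ideal R)
    (hC : ∀ p, p ∈ C ↔ u * p ∈ I) (h₁ : IsWeaklyRegular (R ⧸ C) rs)
    (h₂ : IsWeaklyRegular (R ⧸ (I ⊔ Ideal.span {u})) rs) : IsWeaklyRegular (R ⧸ I) rs := by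
  induction rs generalizing I C with
  | nil => exact .nil _ _
  | cons r rs ih =>
    rw [isWeaklyRegular_quotient_cons_iff] at h₁ h₂ ⊢
    obtain ⟨h₁, h₁'⟩ := h₁
    obtain ⟨h₂, h₂'⟩ := h₂
    -- The induction rests on (I + (r)) : u = C + (r): the exact sequence stays exact modulo r
    -- because r is regular on its right-hand term.
    refine ⟨fun p hp => ?_, ih (I ⊔ Ideal.span {r}) (C ⊔ Ideal.span {r}) (fun p => ?_) h₁' ?_⟩
    · obtain ⟨i, hi, q, rfl⟩ : ∃ i ∈ I, ∃ q, p = i + u * q := by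
        obtain ⟨i, hi, y, hy, rfl⟩ := Submodule.mem_sup.1 (h₂ p (Ideal.mem_sup_left hp))
        obtain ⟨q, rfl⟩ := Ideal.mem_span_singleton.1 hy
        exact ⟨i, hi, q, rfl⟩
      refine I.add_mem hi ((hC q).1 (h₁ q ((hC _).2 ?_)))
      have := I.sub_mem hp (I.mul_mem_left r hi)
      convert this using 1
      ring
    · constructor
      · intro hp
        obtain ⟨c, hc, y, hy, rfl⟩ := Submodule.mem_sup.1 hp
        rw [mul_add]
        exact add_mem (Ideal.mem_sup_left ((hC c).1 hc))
          (Ideal.mem_sup_right (Ideal.mul_mem_left _ _ hy))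
      · intro hp
        obtain ⟨i, hi, y, hy, hiy⟩ := Submodule.mem_sup.1 hp
        obtain ⟨q, rfl⟩ := Ideal.mem_span_singleton.1 hy
        -- Modulo I, r q is the multiple u p of u, so regularity of r modulo I + (u) applies to q.
        have hq : q ∈ I ⊔ Ideal.span {u} := by
          refine h₂ q ?_
          have : r * q = -i + u * p := by rw [← hiy]; ring
          rw [this]
          exact add_mem (Ideal.mem_sup_left (I.neg_mem hi))
            (Ideal.mem_sup_right (Ideal.mul_mem_right _ _ (Ideal.mem_span_singleton_self u)))
        obtain ⟨j, hj, y, hy', rfl⟩ := Submodule.mem_sup.1 hq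
        obtain ⟨s, rfl⟩ := Ideal.mem_span_singleton.1 hy'
        have : p = (p - r * s) + r * s := by ring
        rw [this]
        refine add_mem (Ideal.mem_sup_left ((hC _).2 ?_))
          (Ideal.mem_sup_right (Ideal.mul_mem_right _ _ (Ideal.mem_span_singleton_self r)))
        have : u * (p - r * s) = i + r * j := by
          rw [mul_sub, ← hiy]
          ring
        rw [this]
        exact I.add_mem hi (I.mul_mem_left _ hj)
    · rwa [sup_right_comm] at h₂'

end RegularSequences

/-! ### Associated primes and an upper bound for regular sequences -/

section AssociatedPrimes

variable {R : Type*} [CommRing R] [IsNoetherianRing R]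

/-- If the annihilator of the class of `w` in `R ⧸ I` is contained in the prime `𝔪`, then some
associated prime of `R ⧸ I` lies between it and `𝔪`. -/
theorem exists_prime_colon_le (I 𝔪 : Ideal R) [𝔪.IsPrime] (w : R)
    (hw : ∀ p, p * w ∈ I → p ∈ 𝔪) :
    ∃ (Q : Ideal R) (z : R), Q.IsPrime ∧ Q ≤ 𝔪 ∧ (∀ p, p ∈ Q ↔ p * z ∈ I) ∧
      ∀ p, p * w ∈ I → p ∈ Q := by
  let F : Set (Ideal R) := {Q | Q ≤ 𝔪 ∧ (∃ z, ∀ p, p ∈ Q ↔ p * z ∈ I) ∧ ∀ p, p * w ∈ I → p ∈ Q}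
  have colon : ∀ z, ∃ Q : Ideal R, ∀ p, p ∈ Q ↔ p * z ∈ I := fun z =>
    ⟨Submodule.comap (LinearMap.toSpanSingleton R R z) I, fun p => Iff.rfl⟩
  have hF : F.Nonempty := by
    obtain ⟨Q, hQ⟩ := colon w
    exact ⟨Q, fun p hp => hw p ((hQ p).1 hp), ⟨w, hQ⟩, fun p hp => (hQ p).2 hp⟩
  obtain ⟨Q, ⟨hQm, ⟨z, hz⟩, hQw⟩, hmax⟩ := set_has_maximal_iff_noetherian.2 ‹_› F hF
  refine ⟨Q, z, ⟨?_, ?_⟩, hQm, hz, hQw⟩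
  · rintro rfl
    exact ‹𝔪.IsPrime›.ne_top (top_le_iff.1 hQm)
  · intro a b hab
    by_contra! hcon
    obtain ⟨ha, hb⟩ := hcon
    obtain ⟨Qa, hQa⟩ := colon (a * z)
    have le : ∀ p ∈ Q, p ∈ Qa := fun p hp => (hQa p).2 (by
      rw [mul_left_comm]
      exact I.mul_mem_left _ ((hz p).1 hp))
    -- If I : az lies in 𝔪, it contradicts maximality, as it contains b. Otherwise some s ∉ 𝔪 kills
    -- az modulo I; then I : sz still lies in 𝔪 and contains a, again a contradiction.
    by_cases hQam : Qa ≤ 𝔪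
    · refine hmax Qa ⟨hQam, ⟨_, hQa⟩, fun p hp => le p (hQw p hp)⟩
        (lt_of_le_of_ne le ?_)
      rintro rfl
      apply hb
      rw [hQa, ← mul_assoc, mul_comm b]
      exact (hz _).1 hab
    · obtain ⟨s, hs, hsm⟩ := SetLike.not_le_iff_exists.1 hQam
      obtain ⟨Qs, hQs⟩ := colon (s * z)
      have le' : ∀ p ∈ Q, p ∈ Qs := fun p hp => (hQs p).2 (by
        rw [mul_left_comm]
        exact I.mul_mem_left _ ((hz p).1 hp))
      refine hmax Qs ⟨fun p hp => ?_, ⟨_, hQs⟩, fun p hp => le' p (hQw p hp)⟩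
        (lt_of_le_of_ne le' ?_)
      · rw [hQs, ← mul_assoc, ← hz] at hp
        exact (‹𝔪.IsPrime›.mem_or_mem (hQm hp)).resolve_right hsm
      · rintro rfl
        apply ha
        rw [hQs, mul_left_comm]
        exact (hQa _).1 hs

/-- A form of Nakayama's lemma at a prime ideal `𝔪`. -/
theorem exists_notMem_mul_mem_of_mul_mem_sup (I N 𝔪 : Ideal R) [𝔪.IsPrime] (r s : R)
    (hr : r ∈ 𝔪) (hs : s ∉ 𝔪) (h : ∀ z ∈ N, ∃ y ∈ N, s * z - r * y ∈ I) :
    ∃ e ∉ 𝔪, ∀ z ∈ N, e * z ∈ I := by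
  let N' : Submodule R (R ⧸ I) := Submodule.map I.mkQ N
  let f : N' →ₗ[R] N' := algebraMap R (Module.End R N') s
  have hf : LinearMap.range f ≤ Ideal.span {r} • (⊤ : Submodule R N') := by
    rintro _ ⟨⟨_, z, hz, rfl⟩, rfl⟩
    obtain ⟨y, hy, hzy⟩ := h z hz
    have : f ⟨I.mkQ z, z, hz, rfl⟩ = r • (⟨I.mkQ y, y, hy, rfl⟩ : N') := by
      apply Subtype.ext
      change I.mkQ (s * z) = I.mkQ (r * y)
      rw [← sub_eq_zero, ← map_sub]
      exact (Submodule.Quotient.mk_eq_zero I).2 hzy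
    rw [this]
    exact Submodule.smul_mem_smul (Ideal.mem_span_singleton_self r) trivial
  -- Cayley–Hamilton for multiplication by s on the image of N: p is monic with lower coefficients
  -- in (r) ⊆ 𝔪, so p(s) is congruent to a power of s modulo 𝔪, and p(s) kills the image.
  obtain ⟨p, hp, -, hpc, hpf⟩ :=
    LinearMap.exists_monic_and_natDegree_eq_and_coeff_mem_pow_and_aeval_eq_zero
      R f (Ideal.span {r}) hf
  refine ⟨p.eval s, fun hmem => ?_, fun z hz => ?_⟩
  · rw [Polynomial.eval_eq_sum_range, Finset.sum_range_succ, hp.coeff_natDegree, one_mul] at hmem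
    refine hs (‹𝔪.IsPrime›.mem_of_pow_mem _ ((Ideal.add_mem_iff_right _ ?_).1 hmem))
    refine sum_mem fun k hk => Ideal.mul_mem_right _ _ ?_
    refine (Ideal.span_singleton_le_iff_mem (I := 𝔪)).2 hr ?_
    refine Ideal.pow_le_self ?_ (hpc k)
    have := Finset.mem_range.1 hk
    omega
  · have h1 : Polynomial.aeval f p = algebraMap R (Module.End R N') (p.eval s) := by
      simp only [f, Polynomial.aeval_algebraMap_apply_eq_algebraMap_eval]
    rw [h1] at hpf
    have h2 := congrArg Subtype.val (LinearMap.congr_fun hpf ⟨I.mkQ z, z, hz, rfl⟩)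
    exact (Submodule.Quotient.mk_eq_zero I).1 h2

/-- An associated prime of `R ⧸ I` contained in `𝔪` is strictly contained in an associated prime of
`R ⧸ (I + (r))` contained in `𝔪`, if `r ∈ 𝔪` is regular on `R ⧸ I`. -/
theorem exists_prime_colon_gt (I 𝔪 P : Ideal R) [𝔪.IsPrime] [P.IsPrime] (w r : R)
    (hP : ∀ p, p ∈ P ↔ p * w ∈ I) (hPm : P ≤ 𝔪) (hr : r ∈ 𝔪)
    (hreg : ∀ p, r * p ∈ I → p ∈ I) :
    ∃ (Q : Ideal R) (z : R), Q.IsPrime ∧ Q ≤ 𝔪 ∧ P < Q ∧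
      ∀ p, p ∈ Q ↔ p * z ∈ I ⊔ Ideal.span {r} := by
  -- N = I : P. Some z ∈ N must stay nonzero in the localization of R ⧸ (I + (r)) at 𝔪: otherwise
  -- regularity of r makes N equal to rN modulo I locally, and Nakayama kills w ∈ N.
  obtain ⟨N, hN⟩ : ∃ N : Ideal R, ∀ z, z ∈ N ↔ ∀ p ∈ P, p * z ∈ I := by
    refine ⟨⨅ p ∈ P, Submodule.comap (LinearMap.mulLeft R p) I, fun z => ?_⟩
    simp [Submodule.mem_iInf]
  have hwN : w ∈ N := (hN w).2 fun p hp => (hP p).1 hp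
  have key : ∃ z ∈ N, ∀ p, p * z ∈ I ⊔ Ideal.span {r} → p ∈ 𝔪 := by
    by_contra! hcon
    have hs : ∃ s ∉ 𝔪, ∀ z ∈ N, s * z ∈ I ⊔ Ideal.span {r} := by
      obtain ⟨T, hT⟩ := IsNoetherian.noetherian N
      have hTN : ∀ z ∈ T, z ∈ N := fun z hz => hT ▸ Submodule.subset_span hz
      choose! s hs hsm using hcon
      refine ⟨∏ z ∈ T, s z, fun hmem => ?_, fun z hz => ?_⟩
      · obtain ⟨z, hz, hmem⟩ := (Ideal.IsPrime.prod_mem_iff (p := 𝔪)).1 hmem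
        exact hsm z (hTN z hz) hmem
      · have : N ≤ Submodule.comap (LinearMap.mulLeft R (∏ z ∈ T, s z)) (I ⊔ Ideal.span {r}) := by
          rw [← hT, Submodule.span_le]
          intro z hz
          change (∏ z ∈ T, s z) * z ∈ I ⊔ Ideal.span {r}
          obtain ⟨c, hc⟩ := Finset.dvd_prod_of_mem s hz
          rw [hc, mul_right_comm]
          exact Ideal.mul_mem_right _ _ (hs z (hTN z hz))
        exact this hz
    obtain ⟨s, hsm, hs⟩ := hs
    obtain ⟨e, he, heN⟩ := exists_notMem_mul_mem_of_mul_mem_sup I N 𝔪 r s hr hsm (by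
      intro z hz
      obtain ⟨i, hi, y, hy, hiy⟩ := Submodule.mem_sup.1 (hs z hz)
      obtain ⟨q, rfl⟩ := Ideal.mem_span_singleton.1 hy
      refine ⟨q, (hN q).2 fun p hp => hreg _ ?_, ?_⟩
      · have : r * (p * q) = s * (p * z) - p * i := by linear_combination p * hiy
        rw [this]
        exact I.sub_mem (I.mul_mem_left _ ((hN z).1 hz p hp)) (I.mul_mem_left _ hi)
      · rw [← hiy, add_sub_cancel_right]
        exact hi)
    exact he (hPm ((hP e).2 (heN w hwN)))
  obtain ⟨z₀, hz₀, hz₀m⟩ := key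
  obtain ⟨Q, z, hQ, hQm, hQz, hQ₀⟩ := exists_prime_colon_le (I ⊔ Ideal.span {r}) 𝔪 z₀ hz₀m
  refine ⟨Q, z, hQ, hQm, lt_of_le_of_ne ?_ ?_, hQz⟩
  · exact fun p hp => hQ₀ p (Ideal.mem_sup_left ((hN z₀).1 hz₀ p hp))
  -- The inclusion is strict since Q contains r, whereas r ∈ P would give r w ∈ I, hence w ∈ I and P
  -- = R.
  · rintro rfl
    have hrP : r ∈ P :=
      hQ₀ r (Ideal.mem_sup_right (Ideal.mul_mem_right _ _ (Ideal.mem_span_singleton_self r)))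
    have hw : w ∈ I := hreg w ((hP r).1 hrP)
    exact ‹P.IsPrime›.ne_top ((Ideal.eq_top_iff_one P).2 ((hP 1).2 (by rwa [one_mul])))

/-- A weakly regular sequence in `𝔪` on `R ⧸ I` is at most as long as the dimension of `R ⧸ P`, for
each associated prime `P ≤ 𝔪` of `R ⧸ I`. -/
theorem length_le_coheight (𝔪 : Ideal R) [𝔪.IsPrime] (rs : List R) (I : Ideal R)
    (P : PrimeSpectrum R) (w : R) (hP : ∀ p, p ∈ P.asIdeal ↔ p * w ∈ I) (hPm : P.asIdeal ≤ 𝔪)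
    (hrs : ∀ r ∈ rs, r ∈ 𝔪) (hreg : IsWeaklyRegular (R ⧸ I) rs) :
    (rs.length : ℕ∞) ≤ Order.coheight P := by
  induction rs generalizing I P w with
  | nil => simp
  | cons r rs ih =>
    rw [isWeaklyRegular_quotient_cons_iff] at hreg
    obtain ⟨Q, z, hQ, hQm, hPQ, hQz⟩ := exists_prime_colon_gt I 𝔪 P.asIdeal w r hP hPm
      (hrs r (by simp)) hreg.1
    have := ih (I ⊔ Ideal.span {r}) ⟨Q, hQ⟩ z hQz hQm (fun x hx => hrs x (by simp [hx])) hreg.2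
    calc ((r :: rs).length : ℕ∞) = rs.length + 1 := by simp
      _ ≤ Order.coheight (⟨Q, hQ⟩ : PrimeSpectrum R) + 1 := by gcongr
      _ ≤ _ := Order.coheight_add_one_le hPQ

end AssociatedPrimes

end CriticalIdeal

namespace CriticalIdeal

open MvPolynomial

/-! ### Filtrations by quotients modulo variables -/

section ExponentSets

variable {σ : Type*}

/-- The exponent vectors of the monomials in the ideal generated by the variables in `B`. -/
def variableSet (B : Finset σ) : Set (σ →₀ ℕ) := {d | ∃ b ∈ B, d b ≠ 0}

/-- The monomial ideal with set of exponent vectors `U` is built, by means of extensions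
`0 → S ⧸ (I : u) → S ⧸ I → S ⧸ (I + (u)) → 0` with `u` a monomial, from quotients by ideals
generated by sets of variables which satisfy `P`. -/
inductive HasFiltration (P : Finset σ → Prop) : Set (σ →₀ ℕ) → Prop
  | univ : HasFiltration P Set.univ
  | ofVariables (B : Finset σ) : P B → HasFiltration P (variableSet B)
  | colon (U : Set (σ →₀ ℕ)) (u : σ →₀ ℕ) : IsUpperSet U → HasFiltration P {d | u + d ∈ U} →
      HasFiltration P (U ∪ Set.Ici u) → HasFiltration P U

theorem isUpperSet_variableSet (B : Finset σ) : IsUpperSet (variableSet B) := by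
  rintro d e hde ⟨b, hb, hd⟩
  have := hde b
  exact ⟨b, hb, by omega⟩

theorem HasFiltration.isUpperSet {P : Finset σ → Prop} {U : Set (σ →₀ ℕ)}
    (h : HasFiltration P U) : IsUpperSet U := by
  induction h with
  | univ => exact isUpperSet_univ
  | ofVariables B _ => exact isUpperSet_variableSet B
  | colon U u hU => exact hU

variable [DecidableEq σ]

/-- Peel one variable x_j off m = x_j m'. The colon by x_j replaces m by m', because j ∉ A; adding
x_j absorbs m and leaves only variables. The end m = 1 is the unit ideal, which is why
`HasFiltration.univ` is needed. -/
theorem hasFiltration_variableSet_union_Ici {P : Finset σ → Prop} (A : Finset σ)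
    (hP : ∀ j ∉ A, P (insert j A)) (m : σ →₀ ℕ) (hm : ∀ a ∈ A, m a = 0) :
    HasFiltration P (variableSet A ∪ Set.Ici m) := by
  induction hN : m.degree generalizing m with
  | zero =>
    have : m = 0 := (Finsupp.degree_eq_zero_iff m).1 hN
    subst this
    convert HasFiltration.univ
    ext d
    simp
  | succ N ih =>
    obtain ⟨j, hj⟩ : ∃ j, m j ≠ 0 := by
      by_contra! h
      have : m = 0 := Finsupp.ext h
      simp [this] at hN
    have hjA : j ∉ A := fun h => hj (hm j h)
    obtain ⟨m', rfl⟩ : ∃ m', m = Finsupp.single j 1 + m' := by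
      refine exists_add_of_le ?_
      rw [Finsupp.single_le_iff]
      omega
    have hA : ∀ a ∈ A, (Finsupp.single j 1 : σ →₀ ℕ) a = 0 := fun a ha =>
      Finsupp.single_eq_of_ne (fun h => hjA (h ▸ ha))
    refine .colon _ (Finsupp.single j 1)
      ((isUpperSet_variableSet A).union (isUpperSet_Ici _)) ?_ ?_
    · convert ih m' (fun a ha => ?_) ?_ using 1
      · ext d
        simp only [variableSet, Set.mem_ofPred_eq, Set.mem_union, Set.mem_Ici, add_le_add_iff_left,
          Finsupp.add_apply]
        refine or_congr_left (exists_congr fun b => and_congr_right fun hb => ?_)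
        rw [hA b hb, zero_add]
      · have := hm a ha
        rw [Finsupp.add_apply] at this
        omega
      · rw [map_add, Finsupp.degree_single] at hN
        omega
    · convert HasFiltration.ofVariables (insert j A) (hP j hjA) using 1
      ext d
      simp only [variableSet, Set.mem_ofPred_eq, Set.mem_union, Set.mem_Ici, Finset.mem_insert,
        Finsupp.single_le_iff, exists_eq_or_imp]
      have : Finsupp.single j 1 + m' ≤ d → 1 ≤ d j := fun h => by
        have := h j
        rw [Finsupp.add_apply, Finsupp.single_eq_same] at this
        omega
      rw [← Nat.one_le_iff_ne_zero, or_assoc, or_iff_right_of_imp this, or_comm]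

end ExponentSets

/-! ### Combinatorics of the critical generators -/

section Generators

variable {σ : Type*}

/-- The combinatorial conditions on the variables `v 0, …, v (t - 1)` and the monomials
`M 0, …, M (t - 1)` which define a critical ideal. -/
structure CriticalData (t : ℕ) (v : ℕ → σ) (M : ℕ → σ →₀ ℕ) : Prop where
  pos : 0 < t
  injOn : Set.InjOn v (Set.Iio t)
  apply_eq_zero : ∀ l < t, ∀ k < l, M l (v k) = 0
  last_ne_zero : M (t - 1) ≠ 0

/-- The exponent vector of `x_{v k} M_i ⋯ M_k`, without the variable if `k = t - 1`. -/
noncomputable def tailGenerator (t : ℕ) (v : ℕ → σ) (M : ℕ → σ →₀ ℕ) (i k : ℕ) : σ →₀ ℕ :=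
  (if k + 1 < t then Finsupp.single (v k) 1 else 0) + ∑ l ∈ Finset.Ico i (k + 1), M l

/-- The exponent vectors of the monomials in the ideal
`(x_{v 0}, …, x_{v (i - 1)}, x_{v i} M_i, x_{v (i + 1)} M_i M_{i + 1}, …, M_i ⋯ M_{t - 1})`. -/
def tailSet (t : ℕ) (v : ℕ → σ) (M : ℕ → σ →₀ ℕ) (i : ℕ) : Set (σ →₀ ℕ) :=
  {d | (∃ a < i, d (v a) ≠ 0) ∨ ∃ k, i ≤ k ∧ k < t ∧ tailGenerator t v M i k ≤ d}

theorem isUpperSet_tailSet (t : ℕ) (v : ℕ → σ) (M : ℕ → σ →₀ ℕ) (i : ℕ) :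
    IsUpperSet (tailSet t v M i) := by
  rintro d e hde (⟨a, ha, h⟩ | ⟨k, hik, hkt, h⟩)
  · have := hde (v a)
    exact Or.inl ⟨a, ha, by omega⟩
  · exact Or.inr ⟨k, hik, hkt, h.trans hde⟩

variable {t : ℕ} {v : ℕ → σ} {M : ℕ → σ →₀ ℕ}

theorem tailGenerator_self_add {i k : ℕ} (hik : i < k) :
    tailGenerator t v M i k = M i + tailGenerator t v M (i + 1) k := by
  rw [tailGenerator, tailGenerator, Finset.sum_eq_sum_Ico_succ_bot (by omega), add_left_comm]

theorem le_tailGenerator {i k : ℕ} (hik : i ≤ k) : M i ≤ tailGenerator t v M i k := by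
  rw [tailGenerator, Finset.sum_eq_sum_Ico_succ_bot (by omega), add_left_comm]
  exact le_self_add

theorem CriticalData.hasFiltration_tailSet [DecidableEq σ] (h : CriticalData t v M)
    {P : Finset σ → Prop}
    (hP : ∀ i < t, ∀ j ∉ (Finset.range i).image v, P (insert j ((Finset.range i).image v)))
    (i : ℕ) (hi : i < t) : HasFiltration P (tailSet t v M i) := by
  induction hN : t - 1 - i generalizing i with
  | zero =>
    -- Only the last generator remains, and it carries no extra variable: the ideal is (x_0, …,
    -- x_{t-2}, M_{t-1}).
    obtain rfl : i = t - 1 := by omega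
    convert hasFiltration_variableSet_union_Ici ((Finset.range (t - 1)).image v) (hP _ hi)
      (M (t - 1)) ?_ using 1
    · ext d
      simp only [tailSet, variableSet, Set.mem_ofPred_eq, Set.mem_union, Set.mem_Ici,
        Finset.mem_image, Finset.mem_range, exists_exists_and_eq_and]
      refine or_congr_right ⟨?_, fun hd => ⟨t - 1, le_rfl, hi, ?_⟩⟩
      · rintro ⟨k, hk, -, hd⟩
        exact (le_tailGenerator hk).trans hd
      · have : ¬ t - 1 + 1 < t := by omega
        simpa [tailGenerator, this] using hd
    · simp only [Finset.mem_image, Finset.mem_range, forall_exists_index, and_imp]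
      rintro _ k hk rfl
      exact h.apply_eq_zero _ hi k hk
  | succ N ih =>
    refine .colon _ (M i) (isUpperSet_tailSet t v M i) ?_ ?_
    -- Dividing by M_i turns x_i M_i into the variable x_i and removes the factor M_i from the later
    -- generators.
    · convert ih (i + 1) (by omega) (by omega) using 1
      ext d
      simp only [tailSet, Set.mem_ofPred_eq]
      have h1 : (∃ a < i, (M i + d) (v a) ≠ 0) ↔ ∃ a < i, d (v a) ≠ 0 := by
        refine exists_congr fun a => and_congr_right fun ha => ?_
        rw [Finsupp.add_apply, h.apply_eq_zero i hi a ha, zero_add]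
      have h2 : (∃ k, i ≤ k ∧ k < t ∧ tailGenerator t v M i k ≤ M i + d) ↔
          d (v i) ≠ 0 ∨ ∃ k, i + 1 ≤ k ∧ k < t ∧ tailGenerator t v M (i + 1) k ≤ d := by
        have hself : tailGenerator t v M i i ≤ M i + d ↔ d (v i) ≠ 0 := by
          have hit : i + 1 < t := by omega
          simp only [tailGenerator, hit, if_true, Nat.Ico_succ_singleton, Finset.sum_singleton]
          rw [add_comm, add_le_add_iff_left, Finsupp.single_le_iff, Nat.one_le_iff_ne_zero]
        constructor
        · rintro ⟨k, hik, hkt, hd⟩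
          rcases hik.eq_or_lt with rfl | hik
          · exact Or.inl (hself.1 hd)
          · rw [tailGenerator_self_add hik, add_le_add_iff_left] at hd
            exact Or.inr ⟨k, hik, hkt, hd⟩
        · rintro (hd | ⟨k, hik, hkt, hd⟩)
          · exact ⟨i, le_rfl, hi, hself.2 hd⟩
          · refine ⟨k, by omega, hkt, ?_⟩
            rwa [tailGenerator_self_add hik, add_le_add_iff_left]
      rw [h1, h2, ← or_assoc]
      refine or_congr_left ?_
      simp only [Nat.lt_succ_iff_lt_or_eq, or_and_right, exists_or, exists_eq_left]
    · convert hasFiltration_variableSet_union_Ici ((Finset.range i).image v) (hP _ hi)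
        (M i) ?_ using 1
      · ext d
        simp only [tailSet, variableSet, Set.mem_ofPred_eq, Set.mem_union, Set.mem_Ici,
          Finset.mem_image, Finset.mem_range, exists_exists_and_eq_and]
        have : (∃ k, i ≤ k ∧ k < t ∧ tailGenerator t v M i k ≤ d) → M i ≤ d := by
          rintro ⟨k, hik, -, hd⟩
          exact (le_tailGenerator hik).trans hd
        rw [or_assoc, or_iff_right_of_imp this]
      · simp only [Finset.mem_image, Finset.mem_range, forall_exists_index, and_imp]
        rintro _ k hk rfl
        exact h.apply_eq_zero _ hi k hk

theorem CriticalData.sum_apply_eq (h : CriticalData t v M) {k l : ℕ} (hkl : k ≤ l) (hl : l < t) :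
    (∑ i ∈ Finset.Ico 0 (l + 1), M i) (v k) = (∑ i ∈ Finset.Ico 0 (k + 1), M i) (v k) := by
  rw [← Finset.sum_Ico_consecutive _ (Nat.zero_le (k + 1)) (by omega : k + 1 ≤ l + 1),
    Finsupp.add_apply, Finsupp.finsetSum_apply (Finset.Ico (k + 1) (l + 1)),
    Finset.sum_eq_zero (s := Finset.Ico (k + 1) (l + 1)), add_zero]
  intro i hi
  rw [Finset.mem_Ico] at hi
  exact h.apply_eq_zero i (by omega) k (by omega)

theorem sum_add_le_sum {k l : ℕ} (hkl : k < l) :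
    (∑ i ∈ Finset.Ico 0 (k + 1), M i) + M l ≤ ∑ i ∈ Finset.Ico 0 (l + 1), M i := by
  rw [Finset.sum_Ico_succ_top (Nat.zero_le l)]
  exact add_le_add_left
    (Finset.sum_le_sum_of_subset (Finset.Ico_subset_Ico le_rfl (Nat.succ_le_of_lt hkl))) _

/-- If k < l, the later factors avoid `v k`, so generator k has one more power of `v k` than
generator l. If l < k < t - 1, the same exponent is too large because the products only grow. If l <
k = t - 1, a variable j of the nontrivial last factor takes this role; it differs from `v l`, which
that factor avoids. -/
theorem CriticalData.eq_of_tailGenerator_le (h : CriticalData t v M) {k l : ℕ} (hk : k < t)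
    (hl : l < t) (hle : tailGenerator t v M 0 k ≤ tailGenerator t v M 0 l) : k = l := by
  rcases lt_trichotomy k l with hkl | hkl | hkl
  · have hv : v k ≠ v l := fun hv => hkl.ne (h.injOn hk hl hv)
    have := hle (v k)
    simp only [tailGenerator, Finsupp.add_apply, h.sum_apply_eq hkl.le hl] at this
    rw [if_pos (by omega), Finsupp.single_eq_same] at this
    split_ifs at this
    · rw [Finsupp.single_eq_of_ne hv] at this
      omega
    · simp at this
  · exact hkl
  · have hlt : l + 1 < t := by omega
    by_cases hkt : k + 1 < t
    · have hv : v k ≠ v l := fun hv => hkl.ne' (h.injOn hk hl hv)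
      have h1 := hle (v k)
      have h2 := sum_add_le_sum (M := M) hkl (v k)
      simp only [tailGenerator, Finsupp.add_apply] at h1 h2
      rw [if_pos hkt, if_pos hlt, Finsupp.single_eq_same, Finsupp.single_eq_of_ne hv] at h1
      omega
    · obtain rfl : k = t - 1 := by omega
      obtain ⟨j, hj⟩ := Finsupp.ne_iff.1 h.last_ne_zero
      have hv : j ≠ v l := by
        rintro rfl
        exact hj (h.apply_eq_zero _ hk l hkl)
      have h1 := hle j
      have h2 := sum_add_le_sum (M := M) hkl j
      simp only [tailGenerator, Finsupp.add_apply] at h1 h2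
      rw [if_neg hkt, if_pos hlt, Finsupp.single_eq_of_ne hv] at h1
      simp only [Finsupp.coe_zero, Pi.zero_apply] at h1 hj
      omega

theorem CriticalData.minimal_mem_tailSet_iff (h : CriticalData t v M) (d : σ →₀ ℕ) :
    Minimal (· ∈ tailSet t v M 0) d ↔ d ∈ tailGenerator t v M 0 '' Set.Iio t := by
  have mem : ∀ d, d ∈ tailSet t v M 0 ↔ ∃ k < t, tailGenerator t v M 0 k ≤ d := by
    simp [tailSet]
  constructor
  · rintro ⟨hd, hmin⟩
    obtain ⟨k, hk, hkd⟩ := (mem d).1 hd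
    exact ⟨k, hk, le_antisymm hkd (hmin ((mem _).2 ⟨k, hk, le_rfl⟩) hkd)⟩
  · rintro ⟨k, hk, rfl⟩
    refine ⟨(mem _).2 ⟨k, hk, le_rfl⟩, fun e he hle => ?_⟩
    obtain ⟨l, hl, hle'⟩ := (mem e).1 he
    rwa [h.eq_of_tailGenerator_le hl hk (hle'.trans hle)] at hle'

theorem CriticalData.ncard_minimal (h : CriticalData t v M) :
    {d | Minimal (· ∈ tailSet t v M 0) d}.ncard = t := by
  have : {d | Minimal (· ∈ tailSet t v M 0) d} = tailGenerator t v M 0 '' Set.Iio t :=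
    Set.ext h.minimal_mem_tailSet_iff
  rw [this, Set.InjOn.ncard_image]
  · simp [Set.ncard_eq_toFinset_card']
  · exact fun k hk l hl hkl => h.eq_of_tailGenerator_le hk hl hkl.le

theorem CriticalData.exists_colon_eq_variableSet [DecidableEq σ] (h : CriticalData t v M) :
    ∃ (w : σ →₀ ℕ) (B : Finset σ), B.card = t ∧
      {d | w + d ∈ tailSet t v M 0} = variableSet B := by
  have ht := h.pos
  obtain ⟨j, hj⟩ := Finsupp.ne_iff.1 h.last_ne_zero
  simp only [Finsupp.coe_zero, Pi.zero_apply] at hj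
  have hjv : ∀ k < t - 1, v k ≠ j := by
    rintro k hk rfl
    exact hj (h.apply_eq_zero _ (by omega) k hk)
  obtain ⟨w, hw⟩ : ∃ w, (∑ i ∈ Finset.Ico 0 (t - 1 + 1), M i) = Finsupp.single j 1 + w := by
    refine exists_add_of_le (Finsupp.single_le_iff.2 ?_)
    have : M (t - 1) ≤ ∑ i ∈ Finset.Ico 0 (t - 1 + 1), M i :=
      Finset.single_le_sum (f := M) (fun _ _ => zero_le) (Finset.mem_Ico.2 ⟨by omega, by omega⟩)
    have := this j
    omega
  have hlast : ¬ t - 1 + 1 < t := by omega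
  refine ⟨w, insert j ((Finset.range (t - 1)).image v), ?_, ?_⟩
  · rw [Finset.card_insert_of_notMem, Finset.card_image_of_injOn, Finset.card_range]
    · omega
    · refine h.injOn.mono fun k hk => ?_
      simp only [Finset.coe_range, Set.mem_Iio] at hk ⊢
      omega
    · simp only [Finset.mem_image, Finset.mem_range, not_exists, not_and]
      exact hjv
  · ext d
    simp only [tailSet, variableSet, Set.mem_ofPred_eq, Finset.mem_insert, Finset.mem_image,
      Finset.mem_range, exists_eq_or_imp, exists_exists_and_eq_and, not_lt_zero, false_and,
      exists_false, false_or, Nat.zero_le, true_and]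
    constructor
    · rintro ⟨k, hk, hd⟩
      by_cases hkt : k + 1 < t
      -- Since `v k` differs from j, its exponent in w equals that in M_0 ⋯ M_k, one short of the
      -- generator; d must supply the missing power.
      · refine Or.inr ⟨k, by omega, fun h0 => ?_⟩
        have h1 := hd (v k)
        have h2 := h.sum_apply_eq (by omega : k ≤ t - 1) (by omega)
        rw [hw] at h2
        simp only [tailGenerator, Finsupp.add_apply, if_pos hkt, Finsupp.single_eq_same] at h1 h2
        omega
      · obtain rfl : k = t - 1 := by omega
        left
        have h1 := hd j
        rw [tailGenerator, hw] at h1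
        simp only [Finsupp.add_apply, if_neg hkt, Finsupp.single_eq_same, Finsupp.coe_zero,
          Pi.zero_apply] at h1
        omega
    · rintro (hd | ⟨k, hk, hd⟩)
      · refine ⟨t - 1, by omega, ?_⟩
        rw [tailGenerator, if_neg hlast, zero_add, hw, add_comm]
        gcongr
        exact Finsupp.single_le_iff.2 (by omega)
      -- Conversely M_0 ⋯ M_k divides w: the power of x_j removed from the full product is covered
      -- by the factor M_{t-1}.
      · refine ⟨k, by omega, fun x => ?_⟩
        have h1 := sum_add_le_sum (M := M) hk x
        rw [hw] at h1
        simp only [tailGenerator, if_pos (by omega : k + 1 < t), Finsupp.add_apply] at h1 ⊢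
        by_cases hx : x = v k
        · subst hx
          rw [Finsupp.single_eq_of_ne (hjv k hk)] at h1
          rw [Finsupp.single_eq_same]
          omega
        · rw [Finsupp.single_eq_of_ne hx]
          by_cases hxj : x = j
          · subst hxj
            rw [Finsupp.single_eq_same] at h1
            omega
          · rw [Finsupp.single_eq_of_ne hxj] at h1
            omega

end Generators

end CriticalIdeal

namespace CriticalIdeal

open MvPolynomial RingTheory.Sequence

/-! ### Monomial ideals and differences of variables -/

section MonomialIdeal

variable (K : Type*) [Field K] {σ : Type*}

/-- The ideal generated by the monomials with exponent vector in `U`. -/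
noncomputable def monomialIdeal (U : Set (σ →₀ ℕ)) : Ideal (MvPolynomial σ K) :=
  Ideal.span ((fun d => monomial d (1 : K)) '' U)

variable {K}

theorem mem_monomialIdeal {U : Set (σ →₀ ℕ)} (hU : IsUpperSet U) {p : MvPolynomial σ K} :
    p ∈ monomialIdeal K U ↔ ∀ d ∈ p.support, d ∈ U := by
  rw [monomialIdeal, mem_ideal_span_monomial_image]
  exact forall₂_congr fun d _ => ⟨fun ⟨e, he, hed⟩ => hU hed he, fun h => ⟨d, h, le_rfl⟩⟩

theorem monomial_mem_monomialIdeal {U : Set (σ →₀ ℕ)} (hU : IsUpperSet U) {d : σ →₀ ℕ} :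
    monomial d (1 : K) ∈ monomialIdeal K U ↔ d ∈ U := by
  classical
  rw [mem_monomialIdeal hU, support_monomial, if_neg one_ne_zero]
  simp

theorem isUpperSet_colon {U : Set (σ →₀ ℕ)} (hU : IsUpperSet U) (u : σ →₀ ℕ) :
    IsUpperSet {d | u + d ∈ U} :=
  fun _ _ hde hd => hU (by gcongr) hd

theorem mem_monomialIdeal_colon {U : Set (σ →₀ ℕ)} (hU : IsUpperSet U) (u : σ →₀ ℕ)
    (p : MvPolynomial σ K) :
    p ∈ monomialIdeal K {d | u + d ∈ U} ↔ monomial u 1 * p ∈ monomialIdeal K U := by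
  classical
  rw [mem_monomialIdeal hU, mem_monomialIdeal (isUpperSet_colon hU u)]
  constructor
  · intro h d hd
    rw [mem_support_iff, coeff_monomial_mul'] at hd
    split_ifs at hd with hud
    · have := h (d - u) (by simpa using hd)
      rwa [Set.mem_ofPred_eq, add_tsub_cancel_of_le hud] at this
    · exact absurd rfl hd
  · intro h d hd
    refine h (u + d) ?_
    rw [mem_support_iff, coeff_monomial_mul, one_mul]
    exact mem_support_iff.1 hd

theorem monomialIdeal_union_Ici (U : Set (σ →₀ ℕ)) (u : σ →₀ ℕ) :
    monomialIdeal K (U ∪ Set.Ici u) = monomialIdeal K U ⊔ Ideal.span {monomial u 1} := by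
  rw [monomialIdeal, Set.image_union, Ideal.span_union, ← monomialIdeal]
  congr 1
  apply le_antisymm
  · rw [Ideal.span_le]
    rintro _ ⟨d, hd, rfl⟩
    rw [SetLike.mem_coe, Ideal.mem_span_singleton]
    exact monomial_dvd_monomial.2 ⟨Or.inr hd, dvd_rfl⟩
  · rw [Ideal.span_singleton_le_iff_mem]
    exact Ideal.subset_span ⟨u, Set.self_mem_Ici, rfl⟩

theorem monomialIdeal_variableSet (B : Finset σ) :
    monomialIdeal K (variableSet B) = Ideal.span (X '' (B : Set σ)) := by
  ext p
  rw [mem_monomialIdeal (isUpperSet_variableSet B), mem_ideal_span_X_image]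
  rfl

theorem monomialIdeal_univ : monomialIdeal K (Set.univ : Set (σ →₀ ℕ)) = ⊤ := by
  refine (Ideal.eq_top_iff_one _).2 (Ideal.subset_span ⟨0, trivial, ?_⟩)
  exact (one_def).symm

/-- An ideal `Q` is the kernel of a substitution `φ` if `φ` kills `Q` and is the identity
modulo `Q`. -/
theorem eq_ker_of_X_sub_mem (Q : Ideal (MvPolynomial σ K))
    (φ : MvPolynomial σ K →ₐ[K] MvPolynomial σ K) (h₀ : Q ≤ RingHom.ker φ)
    (h₁ : ∀ x, X x - φ (X x) ∈ Q) : Q = RingHom.ker φ := by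
  refine le_antisymm h₀ fun p hp => ?_
  have h : (Ideal.Quotient.mkₐ K Q).comp φ = Ideal.Quotient.mkₐ K Q := by
    refine algHom_ext fun x => ?_
    exact ((Ideal.Quotient.mk_eq_mk_iff_sub_mem _ _).2 (h₁ x)).symm
  have := AlgHom.congr_fun h p
  rw [AlgHom.comp_apply, (RingHom.mem_ker).1 hp, map_zero] at this
  exact Ideal.Quotient.eq_zero_iff_mem.1 this.symm

theorem isPrime_span_X_image (B : Set σ) :
    (Ideal.span (X '' B) : Ideal (MvPolynomial σ K)).IsPrime := by
  classical
  let φ : MvPolynomial σ K →ₐ[K] MvPolynomial σ K := aeval fun x => if x ∈ B then 0 else X x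
  rw [eq_ker_of_X_sub_mem (Ideal.span (X '' B)) φ]
  · exact RingHom.ker_isPrime φ
  · rw [Ideal.span_le]
    rintro _ ⟨b, hb, rfl⟩
    simp [φ, RingHom.mem_ker, hb]
  · intro x
    by_cases hx : x ∈ B
    · simpa [φ, hx] using Ideal.subset_span (Set.mem_image_of_mem X hx)
    · simp [φ, hx]

/-- The ideal is the kernel of a substitution into a domain, hence prime, so it suffices that X l -
X z has nonzero image. This can fail only if l and some element of C ∪ {z} both lie in B, which `hB`
excludes. -/
theorem X_sub_X_regular (B C T : Finset σ) (z l : σ) (hz : z ∈ T) (hC : C ⊆ T)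
    (hB : ∀ b ∈ B, ∀ b' ∈ B, b ∈ T → b' ∈ T → b = b') (hl : l ∈ T) (hlz : l ≠ z) (hlC : l ∉ C)
    (p : MvPolynomial σ K)
    (hp : (X l - X z) * p ∈
      Ideal.span (X '' (B : Set σ)) ⊔ Ideal.span ((fun c => X c - X z) '' (C : Set σ))) :
    p ∈ Ideal.span (X '' (B : Set σ)) ⊔
      Ideal.span ((fun c => X c - X z) '' (C : Set σ)) := by
  classical
  set Q : Ideal (MvPolynomial σ K) := Ideal.span (X '' (B : Set σ)) ⊔
    Ideal.span ((fun c => X c - X z) '' (C : Set σ)) with hQ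
  have hQB : ∀ b ∈ B, X b ∈ Q := fun b hb =>
    Ideal.mem_sup_left (Ideal.subset_span ⟨b, hb, rfl⟩)
  have hQC : ∀ c, c ∈ C ∨ c = z → X c - X z ∈ Q := by
    rintro c (hc | rfl)
    · exact Ideal.mem_sup_right (Ideal.subset_span ⟨c, hc, rfl⟩)
    · simp
  -- The common image of z and the variables in C, which the ideal identifies: zero as soon as one
  -- of them is in B.
  let E : MvPolynomial σ K := if ∃ b ∈ B, b ∈ C ∨ b = z then 0 else X z
  let f : σ → MvPolynomial σ K := fun x =>
    if x ∈ B then 0 else if x ∈ C ∨ x = z then E else X x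
  let φ : MvPolynomial σ K →ₐ[K] MvPolynomial σ K := aeval f
  have hφ : ∀ x, φ (X x) = f x := fun x => aeval_X _ _
  have hfE : ∀ c, c ∈ C ∨ c = z → f c = E := by
    intro c hc
    by_cases hcB : c ∈ B
    · have : ∃ b ∈ B, b ∈ C ∨ b = z := ⟨c, hcB, hc⟩
      simp only [f, E, if_pos hcB, if_pos this]
    · simp only [f, if_neg hcB, if_pos hc]
  have hker : Q = RingHom.ker φ := by
    refine eq_ker_of_X_sub_mem Q φ (sup_le ?_ ?_) fun x => ?_
    · rw [Ideal.span_le]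
      rintro _ ⟨b, hb, rfl⟩
      rw [SetLike.mem_coe, RingHom.mem_ker, hφ]
      exact if_pos hb
    · rw [Ideal.span_le]
      rintro _ ⟨c, hc, rfl⟩
      rw [SetLike.mem_coe, RingHom.mem_ker, map_sub, hφ, hφ, hfE c (Or.inl hc),
        hfE z (Or.inr rfl), sub_self]
    · rw [hφ]
      by_cases hx : x ∈ C ∨ x = z
      · rw [hfE x hx]
        by_cases hE : ∃ b ∈ B, b ∈ C ∨ b = z
        · obtain ⟨b, hb, hbC⟩ := hE
          simp only [E, if_pos (show ∃ b ∈ B, b ∈ C ∨ b = z from ⟨b, hb, hbC⟩)]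
          have : (X x - 0 : MvPolynomial σ K) = (X x - X z) - (X b - X z) + X b := by ring
          rw [this]
          exact add_mem (sub_mem (hQC x hx) (hQC b hbC)) (hQB b hb)
        · simp only [E, if_neg hE]
          exact hQC x hx
      · by_cases hxB : x ∈ B
        · simpa only [f, if_pos hxB, sub_zero] using hQB x hxB
        · simp [f, if_neg hxB, if_neg hx]
  have hne : φ (X l - X z) ≠ 0 := by
    rw [map_sub, hφ, hφ, hfE z (Or.inr rfl)]
    by_cases hlB : l ∈ B
    · have : ¬ ∃ b ∈ B, b ∈ C ∨ b = z := by
        rintro ⟨b, hb, hbC | rfl⟩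
        · exact hlC (hB l hlB b hb hl (hC hbC) ▸ hbC)
        · exact hlz (hB l hlB b hb hl hz)
      simp [f, E, if_pos hlB, if_neg this, X_ne_zero]
    · have : ¬ (l ∈ C ∨ l = z) := by tauto
      simp only [f, E, if_neg hlB, if_neg this]
      split_ifs
      · simp [X_ne_zero]
      · rw [sub_ne_zero]
        exact fun h => hlz (X_injective h)
  rw [hker, RingHom.mem_ker] at hp ⊢
  rw [map_mul] at hp
  exact (mul_eq_zero.1 hp).resolve_left hne

theorem isWeaklyRegular_X_sub_X_of_span (B T : Finset σ) (z : σ) (hz : z ∈ T)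
    (hB : ∀ b ∈ B, ∀ b' ∈ B, b ∈ T → b' ∈ T → b = b') (L : List σ) (C : Finset σ) (hC : C ⊆ T)
    (hL : ∀ l ∈ L, l ∈ T ∧ l ≠ z ∧ l ∉ C) (hnd : L.Nodup) :
    IsWeaklyRegular (MvPolynomial σ K ⧸ (Ideal.span (X '' (B : Set σ)) ⊔
      Ideal.span ((fun c => X c - X z) '' (C : Set σ)) : Ideal (MvPolynomial σ K)))
      (L.map fun l => (X l - X z : MvPolynomial σ K)) := by
  classical
  induction L generalizing C with
  | nil => exact .nil _ _
  | cons l L ih =>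
    obtain ⟨hlT, hlz, hlC⟩ := hL l (by simp)
    rw [List.nodup_cons] at hnd
    rw [List.map_cons, isWeaklyRegular_quotient_cons_iff]
    refine ⟨X_sub_X_regular B C T z l hz hC hB hlT hlz hlC, ?_⟩
    have := ih (insert l C) (Finset.insert_subset hlT hC) (fun x hx => ?_) hnd.2
    · rwa [Finset.coe_insert, Set.image_insert_eq, Ideal.span_insert, sup_comm (Ideal.span {_}),
        ← sup_assoc] at this
    · obtain ⟨h1, h2, h3⟩ := hL x (by simp [hx])
      refine ⟨h1, h2, ?_⟩
      rw [Finset.mem_insert, not_or]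
      exact ⟨fun h => hnd.1 (h ▸ hx), h3⟩

theorem HasFiltration.isWeaklyRegular {P : Finset σ → Prop} {U : Set (σ →₀ ℕ)}
    (h : HasFiltration P U) (rs : List (MvPolynomial σ K))
    (hrs : ∀ B, P B → IsWeaklyRegular (MvPolynomial σ K ⧸ monomialIdeal K (variableSet B)) rs) :
    IsWeaklyRegular (MvPolynomial σ K ⧸ monomialIdeal K U) rs := by
  induction h with
  | univ =>
    have : Subsingleton (MvPolynomial σ K ⧸ monomialIdeal K (Set.univ : Set (σ →₀ ℕ))) :=
      Ideal.Quotient.subsingleton_iff.2 monomialIdeal_univ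
    exact ⟨fun i hi x y _ => Subsingleton.elim x y⟩
  | ofVariables B hB => exact hrs B hB
  | colon U u hU _ _ ih₁ ih₂ =>
    rw [monomialIdeal_union_Ici] at ih₂
    exact isWeaklyRegular_quotient_of_colon (monomial u 1) rs _ _
      (mem_monomialIdeal_colon hU u) ih₁ ih₂

end MonomialIdeal

/-! ### Depth bounds for monomial quotients -/

section Depth

variable {K : Type*} [Field K] {n : ℕ}

/-- The submodule (rs)(S/I) dies in the nonzero quotient S/(x_1, …, x_n), so it is proper. -/
theorem isRegular_of_isWeaklyRegular {I : Ideal (MvPolynomial (Fin n) K)}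
    (hI : I ≤ idealOfVars (Fin n) K) {rs : List (MvPolynomial (Fin n) K)}
    (hrs : ∀ r ∈ rs, r ∈ idealOfVars (Fin n) K)
    (h : IsWeaklyRegular (MvPolynomial (Fin n) K ⧸ I) rs) :
    IsRegular (MvPolynomial (Fin n) K ⧸ I) rs := by
  refine ⟨h, fun htop => ?_⟩
  have hle : Ideal.ofList rs • (⊤ : Submodule (MvPolynomial (Fin n) K)
      (MvPolynomial (Fin n) K ⧸ I)) ≤ LinearMap.ker (Submodule.factor hI) := by
    refine Submodule.smul_le.2 fun r hr x _ => ?_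
    obtain ⟨p, rfl⟩ := Ideal.Quotient.mk_surjective x
    have hr' : r ∈ idealOfVars (Fin n) K :=
      (Ideal.span_le.2 fun x hx => hrs x hx : Ideal.ofList rs ≤ _) hr
    exact Ideal.Quotient.eq_zero_iff_mem.2 (Ideal.mul_mem_right p _ hr')
  rw [← htop] at hle
  have h1 : (1 : MvPolynomial (Fin n) K) ∈ idealOfVars (Fin n) K :=
    Ideal.Quotient.eq_zero_iff_mem.1 (hle (x := Ideal.Quotient.mk I 1) trivial)
  have : (idealOfVars (Fin n) K).IsPrime := by
    rw [idealOfVars, ← Set.image_univ]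
    exact isPrime_span_X_image _
  exact this.ne_top ((Ideal.eq_top_iff_one _).2 h1)

theorem HasFiltration.le_depth {P : Finset (Fin n) → Prop} {U : Set (Fin n →₀ ℕ)}
    (h : HasFiltration P U) (h0 : (0 : Fin n →₀ ℕ) ∉ U) (T : Finset (Fin n)) (hT : T.Nonempty)
    (hP : ∀ B, P B → ∀ b ∈ B, ∀ b' ∈ B, b ∈ T → b' ∈ T → b = b') :
    ((T.card - 1 : ℕ) : ℕ∞) ≤ depth K n (MvPolynomial (Fin n) K ⧸ monomialIdeal K U) := by
  obtain ⟨z, hz⟩ := hT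
  let rs : List (MvPolynomial (Fin n) K) := (T.erase z).toList.map fun l => X l - X z
  have hlen : rs.length = T.card - 1 := by simp [rs, Finset.card_erase_of_mem hz]
  have hX : ∀ i, (X i : MvPolynomial (Fin n) K) ∈ idealOfVars (Fin n) K := fun i =>
    Ideal.subset_span ⟨i, rfl⟩
  have hrs : ∀ r ∈ rs, r ∈ idealOfVars (Fin n) K := by
    intro r hr
    obtain ⟨l, -, rfl⟩ := List.mem_map.1 hr
    exact sub_mem (hX l) (hX z)
  have hI : monomialIdeal K U ≤ idealOfVars (Fin n) K := by
    intro p hp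
    rw [mem_monomialIdeal h.isUpperSet] at hp
    rw [idealOfVars, ← Set.image_univ, mem_ideal_span_X_image]
    intro d hd
    by_contra! hcon
    have : d = 0 := Finsupp.ext fun i => hcon i trivial
    exact h0 (this ▸ hp d hd)
  have hreg : IsWeaklyRegular (MvPolynomial (Fin n) K ⧸ monomialIdeal K U) rs := by
    refine h.isWeaklyRegular rs fun B hB => ?_
    have := isWeaklyRegular_X_sub_X_of_span (K := K) B T z hz (hP B hB) (T.erase z).toList ∅
      (Finset.empty_subset T) (fun l hl => ?_) (Finset.nodup_toList _)
    · rwa [Finset.coe_empty, Set.image_empty, Ideal.span_empty, sup_bot_eq,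
        ← monomialIdeal_variableSet] at this
    · rw [Finset.mem_toList, Finset.mem_erase] at hl
      exact ⟨hl.2, hl.1, Finset.notMem_empty l⟩
  rw [← hlen]
  exact le_iSup₂_of_le (f := fun (rs : List (MvPolynomial (Fin n) K)) _ => (rs.length : ℕ∞)) rs
    ⟨hrs, isRegular_of_isWeaklyRegular hI hrs hreg⟩ le_rfl

theorem card_le_height (B : Finset (Fin n)) :
    (B.card : ℕ∞) ≤ Order.height
      (⟨Ideal.span (X '' (B : Set (Fin n))), isPrime_span_X_image _⟩ :
        PrimeSpectrum (MvPolynomial (Fin n) K)) := by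
  classical
  induction B using Finset.induction_on with
  | empty => simp
  | insert b B hb ih =>
    rw [Finset.card_insert_of_notMem hb, Nat.cast_add, Nat.cast_one]
    refine (add_le_add_left ih 1).trans (Order.height_add_one_le ?_)
    refine lt_of_le_of_ne ?_ fun h => ?_
    · exact Ideal.span_mono (Set.image_mono (by simp))
    · have h1 := congrArg PrimeSpectrum.asIdeal h
      have h2 : (X b : MvPolynomial (Fin n) K) ∈ Ideal.span (X '' (B : Set (Fin n))) := by
        simp only at h1
        rw [h1]
        exact Ideal.subset_span ⟨b, by simp, rfl⟩
      rw [mem_ideal_span_X_image] at h2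
      obtain ⟨i, hi, hne⟩ := h2 (Finsupp.single b 1) (by simp [support_X])
      rw [Finsupp.single_apply_ne_zero] at hne
      exact hb (hne.1 ▸ hi)

/-- Height plus coheight is at most dim S = n, and adjoining the variables of B one at a time gives
a chain of primes of length |B|. -/
theorem coheight_span_X_image_le (B : Finset (Fin n)) :
    Order.coheight (⟨Ideal.span (X '' (B : Set (Fin n))), isPrime_span_X_image _⟩ :
        PrimeSpectrum (MvPolynomial (Fin n) K)) ≤ ((n - B.card : ℕ) : ℕ∞) := by
  set P : PrimeSpectrum (MvPolynomial (Fin n) K) :=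
    ⟨Ideal.span (X '' (B : Set (Fin n))), isPrime_span_X_image _⟩ with hP
  have hdim : Order.krullDim (PrimeSpectrum (MvPolynomial (Fin n) K)) = (n : WithBot ℕ∞) := by
    have := MvPolynomial.ringKrullDim_of_isNoetherianRing (R := K) (ι := Fin n)
    rw [ringKrullDim_eq_zero_of_field, zero_add, Nat.card_fin] at this
    exact this
  rw [Order.krullDim_eq_iSup_height_add_coheight_of_nonempty] at hdim
  have hdim' : (⨆ a : PrimeSpectrum (MvPolynomial (Fin n) K), Order.height a + Order.coheight a)
      = (n : ℕ∞) := by exact_mod_cast hdim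
  have h1 : Order.height P + Order.coheight P ≤ n := by
    rw [← hdim']
    exact le_iSup (fun a : PrimeSpectrum (MvPolynomial (Fin n) K) =>
      Order.height a + Order.coheight a) P
  have h2 : (B.card : ℕ∞) + Order.coheight P ≤ n :=
    (add_le_add_left (card_le_height B) _).trans h1
  have hlt : Order.coheight P ≠ ⊤ := fun h => by simp [h] at h2
  obtain ⟨c, hc⟩ := ENat.ne_top_iff_exists.1 hlt
  rw [← hc] at h2 ⊢
  have : B.card + c ≤ n := by exact_mod_cast h2
  exact_mod_cast (by omega : c ≤ n - B.card)

theorem depth_le_of_colon_eq {U : Set (Fin n →₀ ℕ)} (hU : IsUpperSet U) (w : Fin n →₀ ℕ)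
    (B : Finset (Fin n)) (hw : {d | w + d ∈ U} = variableSet B) :
    depth K n (MvPolynomial (Fin n) K ⧸ monomialIdeal K U) ≤ ((n - B.card : ℕ) : ℕ∞) := by
  refine iSup₂_le fun rs hrs => ?_
  have hm : (idealOfVars (Fin n) K).IsPrime := by
    rw [idealOfVars, ← Set.image_univ]
    exact isPrime_span_X_image _
  refine (length_le_coheight (idealOfVars (Fin n) K) rs (monomialIdeal K U)
    ⟨Ideal.span (X '' (B : Set (Fin n))), isPrime_span_X_image _⟩ (monomial w 1)
    (fun p => ?_) ?_ hrs.1 hrs.2.toIsWeaklyRegular).trans (coheight_span_X_image_le B)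
  · rw [mul_comm, ← mem_monomialIdeal_colon hU, hw, monomialIdeal_variableSet]
  · exact Ideal.span_mono (Set.image_subset_range _ _)

end Depth

end CriticalIdeal

namespace CriticalIdeal

open MvPolynomial

/-! ### Partitions of the standard monomials into cells -/

section Cells

variable {σ : Type*}

/-- The exponent vectors of the monomials in `x^a K[Z]`. -/
def cell (a : σ →₀ ℕ) (Z : Finset σ) : Set (σ →₀ ℕ) := {d | a ≤ d ∧ ∀ j ∉ Z, d j = a j}

theorem add_mem_cell_add_iff (u e a : σ →₀ ℕ) (Z : Finset σ) :
    u + e ∈ cell (u + a) Z ↔ e ∈ cell a Z := by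
  simp [cell]

theorem le_of_mem_cell_add {u d a : σ →₀ ℕ} {Z : Finset σ} (h : d ∈ cell (u + a) Z) : u ≤ d :=
  le_self_add.trans h.1

/-- A monomial outside U either is not divisible by u, and then lies outside U ∪ (u), or is u times
a monomial outside U : u. So the cells for the colon, translated by u, join the cells for the sum.
-/
theorem HasFiltration.exists_partition [Fintype σ] [DecidableEq σ] {P : Finset σ → Prop}
    {U : Set (σ →₀ ℕ)} (h : HasFiltration P U) (N : ℕ) (hP : ∀ B, P B → N ≤ Bᶜ.card) :
    ∃ (ι : Type) (_ : Finite ι) (a : ι → σ →₀ ℕ) (Z : ι → Finset σ), (∀ i, N ≤ (Z i).card) ∧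
      (∀ d, d ∉ U ↔ ∃ i, d ∈ cell (a i) (Z i)) ∧
      Pairwise fun i j => Disjoint (cell (a i) (Z i)) (cell (a j) (Z j)) := by
  induction h with
  | univ => exact ⟨Empty, inferInstance, Empty.elim, Empty.elim, by simp, by simp, by simp⟩
  | ofVariables B hB =>
    refine ⟨Unit, inferInstance, fun _ => 0, fun _ => Bᶜ, fun _ => hP B hB, fun d => ?_, ?_⟩
    · simp [cell, variableSet]
    · intro i j hij
      exact absurd (Subsingleton.elim i j) hij
  | colon U u hU _ _ ih₁ ih₂ =>
    obtain ⟨ι₁, _, a₁, Z₁, hN₁, hmem₁, hdis₁⟩ := ih₁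
    obtain ⟨ι₂, _, a₂, Z₂, hN₂, hmem₂, hdis₂⟩ := ih₂
    have hdis : ∀ i j, Disjoint (cell (u + a₁ i) (Z₁ i)) (cell (a₂ j) (Z₂ j)) := by
      intro i j
      rw [Set.disjoint_left]
      intro d hd hd'
      exact (hmem₂ d).2 ⟨j, hd'⟩ (Or.inr (le_of_mem_cell_add hd))
    refine ⟨ι₁ ⊕ ι₂, inferInstance, Sum.elim (fun i => u + a₁ i) a₂, Sum.elim Z₁ Z₂, ?_, ?_, ?_⟩
    · rintro (i | i)
      · exact hN₁ i
      · exact hN₂ i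
    · intro d
      simp only [Sum.exists, Sum.elim_inl, Sum.elim_inr]
      rw [← hmem₂]
      by_cases hud : u ≤ d
      · obtain ⟨e, rfl⟩ := exists_add_of_le hud
        simp only [add_mem_cell_add_iff]
        rw [← hmem₁]
        simp
      · have h1 : ¬ ∃ i, d ∈ cell (u + a₁ i) (Z₁ i) := fun ⟨i, hi⟩ =>
          hud (le_of_mem_cell_add hi)
        simp [h1, hud]
    · rintro (i | i) (j | j) hij
      · simp only [Sum.elim_inl]
        rw [Set.disjoint_left]
        intro d hd hd'
        obtain ⟨e, rfl⟩ := exists_add_of_le (le_of_mem_cell_add hd)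
        rw [add_mem_cell_add_iff] at hd hd'
        exact Set.disjoint_left.1 (hdis₁ fun h => hij (congrArg _ h)) hd hd'
      · exact hdis i j
      · exact (hdis j i).symm
      · exact hdis₂ fun h => hij (congrArg _ h)

end Cells

/-! ### Stanley decompositions of monomial quotients -/

section StanleyDecompositions

variable {K : Type*} [Field K] {n : ℕ}

theorem supported_eq_restrictSupport (Z : Finset (Fin n)) :
    Subalgebra.toSubmodule (supported K (Z : Set (Fin n))) =
      restrictSupport K {d : Fin n →₀ ℕ | ∀ j ∉ Z, d j = 0} := by
  ext p
  rw [Subalgebra.mem_toSubmodule, mem_supported, mem_restrictSupport_iff]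
  constructor
  · intro h d hd j hj
    by_contra hdj
    exact hj (h ((mem_vars_iff_mem_support j).2 ⟨d, hd, Finsupp.mem_support_iff.2 hdj⟩))
  · intro h j hj
    obtain ⟨d, hd, hdj⟩ := (mem_vars_iff_mem_support j).1 hj
    by_contra hjZ
    exact Finsupp.mem_support_iff.1 hdj (h hd j hjZ)

variable {U : Set (Fin n →₀ ℕ)}

theorem stanleySpace_monomial (I : Ideal (MvPolynomial (Fin n) K)) (a : Fin n →₀ ℕ)
    (Z : Finset (Fin n)) :
    stanleySpace (K := K) (Ideal.Quotient.mk I (monomial a 1)) Z =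
      Submodule.span K ((fun d => Ideal.Quotient.mk I (monomial d 1)) '' cell a Z) := by
  rw [stanleySpace, supported_eq_restrictSupport, restrictSupport_eq_span, Submodule.map_span,
    Set.image_image]
  congr 1
  have hcell : cell a Z = (fun d => d + a) '' {d : Fin n →₀ ℕ | ∀ j ∉ Z, d j = 0} := by
    ext d
    constructor
    · rintro ⟨had, hd⟩
      obtain ⟨e, rfl⟩ := exists_add_of_le had
      refine ⟨e, fun j hj => ?_, add_comm _ _⟩
      have := hd j hj
      rw [Finsupp.add_apply] at this
      omega
    · rintro ⟨e, he, rfl⟩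
      refine ⟨le_add_self, fun j hj => ?_⟩
      rw [Finsupp.add_apply, he j hj, zero_add]
  rw [hcell, Set.image_image]
  refine Set.image_congr fun d _ => ?_
  change Ideal.Quotient.mk I (monomial d 1 * monomial a 1) = _
  rw [monomial_mul, one_mul]

theorem linearIndependent_standardMonomials (hU : IsUpperSet U) :
    LinearIndependent K fun d : (Uᶜ : Set (Fin n →₀ ℕ)) =>
      Ideal.Quotient.mk (monomialIdeal K U) (monomial (d : Fin n →₀ ℕ) 1) := by
  have h : LinearIndependent K fun d : (Uᶜ : Set (Fin n →₀ ℕ)) =>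
      monomial (d : Fin n →₀ ℕ) (1 : K) := by
    have := (basisMonomials (Fin n) K).linearIndependent.comp
      (Subtype.val : (Uᶜ : Set (Fin n →₀ ℕ)) → _) Subtype.val_injective
    simpa [Function.comp_def] using this
  refine h.map (f := (Ideal.Quotient.mkₐ K (monomialIdeal K U)).toLinearMap) ?_
  rw [Submodule.disjoint_def]
  intro p hp hpI
  have hrange : Set.range (fun d : (Uᶜ : Set (Fin n →₀ ℕ)) => monomial (d : Fin n →₀ ℕ) (1 : K)) =
      (monomial · 1) '' Uᶜ := by
    rw [Set.image_eq_range]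
  rw [hrange, ← restrictSupport_eq_span, mem_restrictSupport_iff] at hp
  have hpI' : p ∈ monomialIdeal K U := Ideal.Quotient.eq_zero_iff_mem.1 hpI
  rw [mem_monomialIdeal hU] at hpI'
  rw [← support_eq_empty, Finset.eq_empty_iff_forall_notMem]
  exact fun d hd => hp hd (hpI' d hd)

/-- The standard monomials form a K-basis of S/I, and each summand is spanned by the part of that
basis in one cell. -/
theorem isInternal_stanleySpace_of_partition (hU : IsUpperSet U) {ι : Type*} [DecidableEq ι]
    (a : ι → Fin n →₀ ℕ) (Z : ι → Finset (Fin n))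
    (hmem : ∀ d, d ∉ U ↔ ∃ i, d ∈ cell (a i) (Z i))
    (hdis : Pairwise fun i j => Disjoint (cell (a i) (Z i)) (cell (a j) (Z j))) :
    DirectSum.IsInternal fun i => stanleySpace (K := K)
      (Ideal.Quotient.mk (monomialIdeal K U) (monomial (a i) 1)) (Z i) := by
  let v : (Uᶜ : Set (Fin n →₀ ℕ)) → MvPolynomial (Fin n) K ⧸ monomialIdeal K U := fun d =>
    Ideal.Quotient.mk (monomialIdeal K U) (monomial (d : Fin n →₀ ℕ) 1)
  have hspace : ∀ i, stanleySpace (K := K)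
      (Ideal.Quotient.mk (monomialIdeal K U) (monomial (a i) 1)) (Z i) =
        Submodule.span K (v '' (Subtype.val ⁻¹' cell (a i) (Z i))) := by
    intro i
    rw [stanleySpace_monomial]
    congr 1
    ext x
    constructor
    · rintro ⟨d, hd, rfl⟩
      exact ⟨⟨d, (hmem d).2 ⟨i, hd⟩⟩, hd, rfl⟩
    · rintro ⟨d, hd, rfl⟩
      exact ⟨d, hd, rfl⟩
  simp only [hspace]
  refine DirectSum.isInternal_submodule_of_iSupIndep_of_iSup_eq_top ?_ ?_
  · intro i
    have : (⨆ j, ⨆ (_ : j ≠ i), Submodule.span K (v '' (Subtype.val ⁻¹' cell (a j) (Z j)))) =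
        Submodule.span K (v '' (⋃ j, ⋃ (_ : j ≠ i), Subtype.val ⁻¹' cell (a j) (Z j))) := by
      simp only [Set.image_iUnion, Submodule.span_iUnion]
    rw [this]
    refine (linearIndependent_standardMonomials hU).disjoint_span_image ?_
    simp only [Set.disjoint_iUnion_right]
    exact fun j hj => (hdis hj.symm).preimage _
  · rw [eq_top_iff]
    intro x _
    obtain ⟨p, rfl⟩ := Ideal.Quotient.mk_surjective x
    rw [p.as_sum, map_sum]
    refine sum_mem fun d _ => ?_
    have hsmul : Ideal.Quotient.mk (monomialIdeal K U) (monomial d (coeff d p)) =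
        coeff d p • Ideal.Quotient.mk (monomialIdeal K U) (monomial d (1 : K)) := by
      have : monomial d (coeff d p) = coeff d p • monomial d (1 : K) := by
        rw [smul_monomial, smul_eq_mul, mul_one]
      rw [this]
      rfl
    rw [hsmul]
    refine Submodule.smul_mem _ _ ?_
    by_cases hd : d ∈ U
    · rw [Ideal.Quotient.eq_zero_iff_mem.2 ((monomial_mem_monomialIdeal hU).2 hd)]
      exact zero_mem _
    · obtain ⟨i, hi⟩ := (hmem d).1 hd
      exact Submodule.mem_iSup_of_mem i (Submodule.subset_span ⟨⟨d, hd⟩, hi, rfl⟩)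

theorem exists_stanleyDecomposition_of_partition (hU : IsUpperSet U) {ι : Type} [Finite ι]
    (a : ι → Fin n →₀ ℕ) (Z : ι → Finset (Fin n))
    (hmem : ∀ d, d ∉ U ↔ ∃ i, d ∈ cell (a i) (Z i))
    (hdis : Pairwise fun i j => Disjoint (cell (a i) (Z i)) (cell (a j) (Z j)))
    (N : ℕ) (hN : ∀ i, N ≤ (Z i).card) :
    ∃ D : StanleyDecomposition (quotientGrading (monomialIdeal K U)), (N : ℕ∞) ≤ D.sdepth := by
  obtain ⟨r, ⟨e⟩⟩ := Finite.exists_equiv_fin ι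
  let f := e.symm
  refine ⟨⟨r, fun i => Ideal.Quotient.mk _ (monomial (a (f i)) 1), fun i => Z (f i),
    fun i => ?_, fun i => ?_, ?_⟩, ?_⟩
  · refine ⟨fun j => (a (f i) j : ℤ), monomial (a (f i)) 1, ?_, rfl⟩
    rw [SetLike.mem_coe, monomial_mem_restrictSupport]
    exact Or.inl fun _ => rfl
  · intro p hp q hq hpq
    have hsub : p - q ∈ Subalgebra.toSubmodule (supported K (Z (f i) : Set (Fin n))) :=
      sub_mem hp hq
    rw [supported_eq_restrictSupport, mem_restrictSupport_iff] at hsub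
    have hI : monomial (a (f i)) 1 * (p - q) ∈ monomialIdeal K U := by
      rw [mul_comm]
      refine Ideal.Quotient.eq_zero_iff_mem.1 ?_
      rw [sub_mul, map_sub]
      exact sub_eq_zero.2 hpq
    rw [← mem_monomialIdeal_colon hU, mem_monomialIdeal (isUpperSet_colon hU _)] at hI
    rw [← sub_eq_zero, ← support_eq_empty, Finset.eq_empty_iff_forall_notMem]
    intro d hd
    refine (hmem (a (f i) + d)).2 ⟨f i, le_self_add, fun j hj => ?_⟩ (hI d hd)
    rw [Finsupp.add_apply, hsub hd j hj, add_zero]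
  · exact isInternal_stanleySpace_of_partition hU (fun i => a (f i)) (fun i => Z (f i))
      (fun d => (hmem d).trans f.surjective.exists)
      (fun i j hij => hdis fun h => hij (f.injective h))
  · exact le_iInf fun i => by exact_mod_cast hN (f i)

/-- A standard monomial `x^w` lies in one of the summands `u K[Z]` of a Stanley decomposition. Then
`x^w` is not annihilated by the variables in `Z`. -/
theorem StanleyDecomposition.exists_forall_mem_add_notMem (hU : IsUpperSet U)
    (D : StanleyDecomposition (quotientGrading (monomialIdeal K U))) (w : Fin n →₀ ℕ)
    (hw : w ∉ U) : ∃ i, ∀ k ∈ D.Z i, w + Finsupp.single k 1 ∉ U := by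
  classical
  choose b hb using D.homogeneous
  choose q hq hqu using hb
  -- Freeness makes the generator nonzero, and a degree determines at most one exponent vector, so
  -- the lift is a single term.
  have hq' : ∀ i, ∃ (a : Fin n →₀ ℕ) (c : K), q i = monomial a c ∧ c ≠ 0 := by
    intro i
    have hu0 : D.u i ≠ 0 := by
      intro h0
      have := D.free i (Subalgebra.zero_mem _) (Subalgebra.one_mem _) (by simp [h0])
      exact zero_ne_one this
    have hqi : q i ≠ 0 := by
      intro h0
      rw [← hqu i, h0, map_zero] at hu0
      exact hu0 rfl
    obtain ⟨a, ha⟩ := support_nonempty.2 hqi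
    refine ⟨a, coeff a (q i), ?_, mem_support_iff.1 ha⟩
    ext d
    rw [coeff_monomial]
    split_ifs with had
    · rw [had]
    · by_contra hd
      have h1 := hq i ha
      have h2 := hq i (mem_support_iff.2 hd)
      refine had (Finsupp.ext fun j => ?_)
      have h3 := h1 j
      have h4 := h2 j
      omega
  choose a c hqa hc using hq'
  have hu : ∀ i, D.u i = Ideal.Quotient.mk (monomialIdeal K U) (monomial (a i) (c i)) := by
    intro i
    rw [← hqa, ← hqu i]
    rfl
  -- The coefficient of x^w is well defined on S/I as w ∉ U. If w were in no cell, it would vanish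
  -- on every summand, hence on S/I, yet it is 1 on x^w.
  have hex : ∃ i, w ∈ cell (a i) (D.Z i) := by
    by_contra! hcon
    let φ : (MvPolynomial (Fin n) K ⧸ monomialIdeal K U) →ₗ[K] K :=
      ((monomialIdeal K U).restrictScalars K).liftQ (lcoeff K w) (by
        intro p hp
        rw [LinearMap.mem_ker, lcoeff_apply]
        by_contra hne
        exact hw ((mem_monomialIdeal hU).1 hp w (mem_support_iff.2 hne)))
    have hφ : ∀ p, φ (Ideal.Quotient.mk (monomialIdeal K U) p) = coeff w p := fun p => rfl
    have htop : (⊤ : Submodule K (MvPolynomial (Fin n) K ⧸ monomialIdeal K U)) ≤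
        LinearMap.ker φ := by
      rw [← D.isInternal.submodule_iSup_eq_top]
      refine iSup_le fun i => ?_
      rintro _ ⟨p, hp, rfl⟩
      rw [supported_eq_restrictSupport, SetLike.mem_coe, mem_restrictSupport_iff] at hp
      change φ (p • D.u i) = 0
      rw [hu i]
      change φ (Ideal.Quotient.mk (monomialIdeal K U) (p * monomial (a i) (c i))) = 0
      rw [hφ, coeff_mul_monomial']
      split_ifs with haw
      · by_contra hne
        refine hcon i ⟨haw, fun j hj => ?_⟩
        have h1 := hp (mem_support_iff.2 (left_ne_zero_of_mul hne)) j hj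
        have h2 := haw j
        rw [Finsupp.tsub_apply] at h1
        omega
      · rfl
    have h1 := htop (x := Ideal.Quotient.mk (monomialIdeal K U) (monomial w 1)) trivial
    rw [LinearMap.mem_ker, hφ, coeff_monomial, if_pos rfl] at h1
    exact one_ne_zero h1
  obtain ⟨i, hi⟩ := hex
  refine ⟨i, fun k hk hwk => ?_⟩
  obtain ⟨e, rfl⟩ := exists_add_of_le hi.1
  have hsupp : monomial (e + Finsupp.single k 1) (1 : K) ∈
      Subalgebra.toSubmodule (supported K (D.Z i : Set (Fin n))) := by
    rw [supported_eq_restrictSupport, monomial_mem_restrictSupport]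
    left
    intro j hj
    have h1 := hi.2 j hj
    have h2 : j ≠ k := fun h => hj (h ▸ hk)
    rw [Finsupp.add_apply] at h1 ⊢
    rw [Finsupp.single_eq_of_ne h2]
    omega
  -- If x_k x^w were in I, the nonzero element x^e x_k of K[Z] would annihilate the generator,
  -- against freeness.
  have hzero : monomial (e + Finsupp.single k 1) (1 : K) • D.u i = 0 := by
    rw [hu i]
    change Ideal.Quotient.mk (monomialIdeal K U)
      (monomial (e + Finsupp.single k 1) 1 * monomial (a i) (c i)) = 0
    rw [monomial_mul, one_mul, Ideal.Quotient.eq_zero_iff_mem, mem_monomialIdeal hU]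
    intro d hd
    rw [support_monomial, if_neg (hc i), Finset.mem_singleton] at hd
    rw [hd]
    convert hwk using 1
    abel
  have := D.free i hsupp (Subalgebra.zero_mem _) (by simpa using hzero)
  rw [monomial_eq_zero] at this
  exact one_ne_zero this

theorem StanleyDecomposition.sdepth_le_of_colon_eq (hU : IsUpperSet U) (w : Fin n →₀ ℕ)
    (B : Finset (Fin n)) (hw : {d | w + d ∈ U} = variableSet B)
    (D : StanleyDecomposition (quotientGrading (monomialIdeal K U))) :
    D.sdepth ≤ ((n - B.card : ℕ) : ℕ∞) := by
  have hmem : ∀ d, w + d ∈ U ↔ d ∈ variableSet B := fun d => Set.ext_iff.1 hw d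
  obtain ⟨i, hi⟩ := D.exists_forall_mem_add_notMem hU w (by
    have := hmem 0
    rw [add_zero] at this
    simp [this, variableSet])
  refine (iInf_le _ i).trans ?_
  have hsub : D.Z i ⊆ Bᶜ := by
    intro k hk
    rw [Finset.mem_compl]
    intro hkB
    exact hi k hk ((hmem _).2 ⟨k, hkB, by simp⟩)
  have := Finset.card_le_card hsub
  rw [Finset.card_compl, Fintype.card_fin] at this
  exact_mod_cast this

end StanleyDecompositions

end CriticalIdeal

/-! ### Critical ideals as monomial ideals, and the main theorem -/

namespace CriticalIdeal

open MvPolynomial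

theorem monomialIdeal_tailSet (K : Type*) [Field K] {σ : Type*} (t : ℕ) (v : ℕ → σ)
    (M : ℕ → σ →₀ ℕ) :
    monomialIdeal K (tailSet t v M 0) =
      Ideal.span ((fun k => monomial (tailGenerator t v M 0 k) (1 : K)) '' Set.Iio t) := by
  apply le_antisymm
  · rw [monomialIdeal, Ideal.span_le]
    rintro _ ⟨d, hd, rfl⟩
    obtain ⟨a, ha, -⟩ | ⟨k, -, hk, hkd⟩ := hd
    · exact absurd ha (Nat.not_lt_zero a)
    · refine Ideal.mem_of_dvd _ (monomial_dvd_monomial.2 ⟨Or.inr hkd, dvd_rfl⟩)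
        (Ideal.subset_span ⟨k, hk, rfl⟩)
  · rw [Ideal.span_le]
    rintro _ ⟨k, hk, rfl⟩
    exact Ideal.subset_span ⟨_, Or.inr ⟨k, Nat.zero_le k, hk, le_rfl⟩, rfl⟩

section Critical

variable {K : Type*} [Field K] {n t : ℕ}

theorem IsCanonicalCritical.exists_criticalData {I : Ideal (MvPolynomial (Fin n) K)}
    (hI : IsCanonicalCritical t I) :
    t ≤ n ∧ ∃ (v : ℕ → Fin n) (M : ℕ → Fin n →₀ ℕ), CriticalData t v M ∧
      I = monomialIdeal K (tailSet t v M 0) := by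
  obtain ⟨ht, htn, m, π, hm, hdeg, rfl⟩ := hI
  refine ⟨htn, ?_⟩
  -- The permutation is absorbed into the variables and monomials; values at indices out of range
  -- are irrelevant defaults.
  let v : ℕ → Fin n := fun k => if h : k < n then π ⟨k, h⟩ else π ⟨0, by omega⟩
  let M : ℕ → Fin n →₀ ℕ := fun l => if h : l < t then (m ⟨l, h⟩).mapDomain π else 0
  have hv : ∀ i : Fin t, v i = π (Fin.castLE htn i) := fun i =>
    dif_pos (lt_of_lt_of_le i.2 htn)
  have hM : ∀ i : Fin t, M i = (m i).mapDomain π := fun i => dif_pos i.2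
  have hprod : ∀ i : Fin t, rename π (∏ k ∈ Finset.Iic i, monomial (m k) (1 : K)) =
      monomial (∑ l ∈ Finset.Ico 0 ((i : ℕ) + 1), M l) 1 := by
    intro i
    rw [map_prod, monomial_sum_one]
    have : Finset.Ico 0 ((i : ℕ) + 1) = (Finset.Iic i).map Fin.valEmbedding := by
      rw [Fin.map_valEmbedding_Iic]
      ext l
      simp
    rw [this, Finset.prod_map]
    refine Finset.prod_congr rfl fun k _ => ?_
    rw [rename_monomial, Fin.valEmbedding_apply, hM]
  have hgen : ∀ i : Fin t, (i : ℕ) + 1 < t →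
      rename π (X (Fin.castLE htn i) * ∏ k ∈ Finset.Iic i, monomial (m k) (1 : K)) =
        monomial (tailGenerator t v M 0 i) 1 := by
    intro i hi
    rw [map_mul, hprod, rename_X, X, monomial_mul, one_mul, tailGenerator, if_pos hi, hv]
  have hlast : rename π (∏ k, monomial (m k) (1 : K)) =
      monomial (tailGenerator t v M 0 (t - 1)) 1 := by
    have huniv : (Finset.univ : Finset (Fin t)) = Finset.Iic ⟨t - 1, by omega⟩ := by
      ext k
      simp only [Finset.mem_univ, Finset.mem_Iic, Fin.le_def, true_iff]
      omega
    rw [huniv, hprod, tailGenerator, if_neg (by omega), zero_add]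
  refine ⟨v, M, ⟨ht, ?_, ?_, ?_⟩, ?_⟩
  · intro k hk l hl hkl
    rw [hv ⟨k, hk⟩, hv ⟨l, hl⟩] at hkl
    exact Fin.val_eq_of_eq (Fin.castLE_injective htn (π.injective hkl))
  · intro l hl k hk
    rw [hv ⟨k, hk.trans hl⟩, hM ⟨l, hl⟩, Finsupp.mapDomain_apply π.injective]
    exact hm ⟨l, hl⟩ _ hk
  · rw [hM ⟨t - 1, by omega⟩]
    intro h0
    rw [← Finsupp.mapDomain_zero (f := π)] at h0
    rw [Finsupp.mapDomain_injective π.injective h0] at hdeg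
    simp at hdeg
  · rw [monomialIdeal_tailSet, criticalIdeal, Ideal.map_span]
    congr 1
    ext p
    constructor
    · rintro ⟨_, ⟨i, hi, rfl⟩ | rfl, rfl⟩
      · exact ⟨i, i.2, (hgen i hi).symm⟩
      · exact ⟨t - 1, Nat.sub_lt ht one_pos, hlast.symm⟩
    · rintro ⟨k, hk, rfl⟩
      by_cases hkt : k + 1 < t
      · exact ⟨_, Or.inl ⟨⟨k, hk⟩, hkt, rfl⟩, hgen ⟨k, hk⟩ hkt⟩
      · have hk' : k < t := hk
        obtain rfl : k = t - 1 := by omega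
        exact ⟨_, Or.inr rfl, hlast⟩

end Critical

end CriticalIdeal

open CriticalIdeal in
theorem theorem2p2 {K : Type*} [Field K] {n t : ℕ} (I : Ideal (MvPolynomial (Fin n) K))
    (hI : CriticalIdeal.IsCanonicalCritical t I) :
    (∃ D : CriticalIdeal.StanleyDecomposition (CriticalIdeal.quotientGrading I),
      D.sdepth = CriticalIdeal.sdepth (CriticalIdeal.quotientGrading I)) ∧
    CriticalIdeal.sdepth (CriticalIdeal.quotientGrading I) =
      CriticalIdeal.depth K n (MvPolynomial (Fin n) K ⧸ I) ∧
    CriticalIdeal.depth K n (MvPolynomial (Fin n) K ⧸ I) =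
      ((n - (CriticalIdeal.minimalGenerators I).ncard : ℕ) : ℕ∞) ∧
    (CriticalIdeal.minimalGenerators I).ncard = t := by
  obtain ⟨htn, v, M, hdata, rfl⟩ := hI.exists_criticalData
  have ht := hdata.pos
  have hU := isUpperSet_tailSet t v M 0
  have hcard : (minimalGenerators (monomialIdeal K (tailSet t v M 0))).ncard = t := by
    simp only [minimalGenerators, monomial_mem_monomialIdeal hU]
    exact hdata.ncard_minimal
  obtain ⟨w, B, hB, hw⟩ := hdata.exists_colon_eq_variableSet
  let A : Finset (Fin n) := (Finset.range (t - 1)).image v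
  have hA : A.card = t - 1 := by
    rw [Finset.card_image_of_injOn, Finset.card_range]
    refine hdata.injOn.mono fun k hk => ?_
    simp only [Finset.coe_range, Set.mem_Iio] at hk ⊢
    omega
  -- The cardinality bound serves the Stanley depth; having at most one element outside A serves the
  -- regular sequence of differences.
  have hfilt : HasFiltration (fun B : Finset (Fin n) => B.card ≤ t ∧
      ∀ b ∈ B, ∀ b' ∈ B, b ∈ Aᶜ → b' ∈ Aᶜ → b = b') (tailSet t v M 0) := by
    refine hdata.hasFiltration_tailSet (fun i hi j _ => ⟨?_, ?_⟩) 0 ht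
    · refine (Finset.card_insert_le _ _).trans ?_
      have := Finset.card_image_le (s := Finset.range i) (f := v)
      rw [Finset.card_range] at this
      omega
    · have key : ∀ b ∈ insert j ((Finset.range i).image v), b ∈ Aᶜ → b = j := by
        intro b hb hbA
        refine (Finset.mem_insert.1 hb).resolve_right fun hb => Finset.mem_compl.1 hbA ?_
        refine Finset.image_subset_image (fun k hk => ?_) hb
        rw [Finset.mem_range] at hk ⊢
        omega
      intro b hb b' hb' hbA hbA'
      rw [key b hb hbA, key b' hb' hbA']
  have h0 : (0 : Fin n →₀ ℕ) ∉ tailSet t v M 0 := by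
    intro h0
    have h1 : (0 : Fin n →₀ ℕ) ∈ {d | w + d ∈ tailSet t v M 0} := hU (zero_le) h0
    rw [hw] at h1
    obtain ⟨b, -, hb⟩ := h1
    exact hb rfl
  have hAc : Aᶜ.card = n - (t - 1) := by rw [Finset.card_compl, hA, Fintype.card_fin]
  have hdepth : depth K n (MvPolynomial (Fin n) K ⧸ monomialIdeal K (tailSet t v M 0)) =
      ((n - t : ℕ) : ℕ∞) := by
    apply le_antisymm
    · have := depth_le_of_colon_eq (K := K) hU w B hw
      rwa [hB] at this
    -- Aᶜ has n - t + 1 elements; one is the base point z, leaving n - t differences.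
    · have := hfilt.le_depth (K := K) h0 Aᶜ (Finset.card_pos.1 (by omega)) fun B hB => hB.2
      rwa [hAc, (by omega : n - (t - 1) - 1 = n - t)] at this
  obtain ⟨ι, _, a, Z, hZ, hmem, hdis⟩ := hfilt.exists_partition (n - t) fun B hB => by
    rw [Finset.card_compl, Fintype.card_fin]
    have := hB.1
    omega
  obtain ⟨D, hD⟩ := exists_stanleyDecomposition_of_partition (K := K) hU a Z hmem hdis (n - t) hZ
  have hle : ∀ D : StanleyDecomposition (quotientGrading (monomialIdeal K (tailSet t v M 0))),
      D.sdepth ≤ ((n - t : ℕ) : ℕ∞) := fun D => by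
    have := D.sdepth_le_of_colon_eq hU w B hw
    rwa [hB] at this
  have hsdepth : sdepth (quotientGrading (monomialIdeal K (tailSet t v M 0))) =
      ((n - t : ℕ) : ℕ∞) :=
    le_antisymm (iSup_le hle) (hD.trans (le_iSup StanleyDecomposition.sdepth D))
  exact ⟨⟨D, (le_antisymm (hle D) hD).trans hsdepth.symm⟩, hsdepth.trans hdepth.symm,
    by rw [hdepth, hcard], hcard⟩
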